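/- **Theorem (Two-sender simultaneous decoding).** Let $\mathcal X_1,\mathcal X_2$ be finite alphabets, let $(x_1,x_2)\mapsto\rho_{x_1,x_2}$ be a classical-quantum multiple access channel whose outputs are density operators on a finite-dimensional Hilbert space $\mathcal H^B$, and let $p_1,p_2$ be probability distributions on $\mathcal X_1,\mathcal X_2$. Put $$\bar\rho_{x_1}=\sum_{x_2}p_2(x_2)\rho_{x_1,x_2},\qquad \bar\rho_{x_2}=\sum_{x_1}p_1(x_1)\rho_{x_1,x_2},\qquad \bar\rho=\sum_{x_1,x_2}p_1(x_1)p_2(x_2)\rho_{x_1,x_2}.$$ Let $H(\rho)=-\operatorname{Tr}(\rho\log_2\rho)$ and $$H(B)=H(\bar\rho),\quad H(B|X_1)=\sum_{x_1}p_1(x_1)H(\bar\rho_{x_1}),\quad H(B|X_2)=\sum_{x_2}p_2(x_2)H(\bar\rho_{x_2}),\quad H(B|X_1X_2)=\sum_{x_1,x_2}p_1(x_1)p_2(x_2)H(\rho_{x_1,x_2}),$$ $$I(X_1;B|X_2)=H(B|X_2)-H(B|X_1X_2),\quad I(X_2;B|X_1)=H(B|X_1)-H(B|X_1X_2),\quad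 I(X_1X_2;B)=H(B)-H(B|X_1X_2).$$ *Typical projectors.* For density operators $\tau_1,\dots,\tau_n$ with orthonormal eigenbases $\tau_i=\sum_y q_i(y)|e_{i,y}\rangle\langle e_{i,y}|$, and for $h\in\mathbb R$, $\eta>0$, let $\Pi(\tau_1\otimes\dots\otimes\tau_n;h,\eta)$ be the orthogonal projector onto the span of the vectors $e_{1,y_1}\otimes\dots\otimes e_{n,y_n}$ with $q_1(y_1)\cdots q_n(y_n)>0$ and $\left|-\tfrac1n\log_2\big(q_1(y_1)\cdots q_n(y_n)\big)-h\right|\le\eta$. *Decoder.* Write $\rho_{x_1^n,x_2^n}=\bigotimes_i\rho_{x_{1,i},x_{2,i}}$ and $\bar\rho_{x_1^n}=\bigotimes_i\bar\rho_{x_{1,i}}$. For codebooks $\{x_1^n(m_1)\}_{m_1\in\mathcal M_1}\subset\mathcal X_1^n$ and $\{x_2^n(m_2)\}_{m_2\in\mathcal M_2}\subset\mathcal X_2^n$ put $\rho_{m_1,m_2}=\rho_{x_1^n(m_1),x_2^n(m_2)}$ and $$\Pi=\Pi(\bar\rho^{\otimes n};H(B),\eta),\quad \Pi_{m_1}=\Pi(\bar\rho_{x_1^n(m_1)};H(B|X_1),\eta),\quad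 \Pi_{m_1,m_2}=\Pi(\rho_{m_1,m_2};H(B|X_1X_2),\eta),$$ $$\Pi'_{m_1,m_2}=\Pi\,\Pi_{m_1}\Pi_{m_1,m_2}\Pi_{m_1}\Pi,\qquad \Lambda_{m_1,m_2}=\Big(\sum_{m_1',m_2'}\Pi'_{m_1',m_2'}\Big)^{-1/2}\Pi'_{m_1,m_2}\Big(\sum_{m_1',m_2'}\Pi'_{m_1',m_2'}\Big)^{-1/2},$$ where the inverse square root is taken on the support. For operators $\{\Gamma_{m_1,m_2}\}$, which may depend on the codebooks, the average error probability is $\overline p_e(\Gamma)=\frac1{|\mathcal M_1||\mathcal M_2|}\sum_{m_1,m_2}\operatorname{Tr}\{(I-\Gamma_{m_1,m_2})\rho_{m_1,m_2}\}$, and $\mathbb E\,\overline p_e(\Gamma)$ is its expectation when all letters of all codewords $x_1^n(m_1)$, $x_2^n(m_2)$ are drawn independently from $p_1$, respectively $p_2$. *Claim.* Let $R_1,R_2\in\mathbb R$ satisfy $$R_1\le I(X_1;B|X_2),\qquad R_2\le I(X_2;B|X_1),\qquad R_1+R_2\le I(X_1X_2;B).$$ Then for all $\varepsilon>0$, $\delta>0$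 and $0<\eta<\delta/2$ there is an $N$ such that for all $n\ge N$ and all message sets $\mathcal M_1,\mathcal M_2$ of sizes $1\le|\mathcal M_i|\le\lceil 2^{n(R_i-\delta)}\rceil$ ($i=1,2$): 1. for every pair of codebooks, the operators $\Lambda_{m_1,m_2}$ together with the failure outcome $I-\sum_{m_1,m_2}\Lambda_{m_1,m_2}$ form a POVM; 2. $\mathbb E\,\overline p_e(\Lambda)\le\varepsilon$; 3. for every pair of codebooks there is a POVM $\{\Lambda^*_{m_1,m_2}\}_{m_1\in\mathcal M_1,m_2\in\mathcal M_2}$, $\sum_{m_1,m_2}\Lambda^*_{m_1,m_2}=I$, with $\Lambda^*_{m_1,m_2}\ge\Lambda_{m_1,m_2}$ for all $m_1,m_2$, such that $\mathbb E\,\overline p_e(\Lambda^*)\le\varepsilon$. -/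

import Mathlib

open scoped ComplexOrder

noncomputable section

namespace QuantumMAC

variable {d : Type*} [Fintype d] [DecidableEq d]

/-- Density operators on the Hilbert space `ℂ^d`. -/
structure DensityMatrix (d : Type*) [Fintype d] where
  val : Matrix d d ℂ
  posSemidef : val.PosSemidef
  trace_eq_one : val.trace = 1

namespace DensityMatrix

/-- The eigenvalues of `ρ`, a probability distribution on `d`. -/
def eigenvalue (ρ : DensityMatrix d) (y : d) : ℝ :=
  ρ.posSemidef.isHermitian.eigenvalues y

/-- An orthonormal eigenbasis of `ρ`; `ρ.eigenvector y` belongs to `ρ.eigenvalue y`. -/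
def eigenvector (ρ : DensityMatrix d) (y : d) : EuclideanSpace ℂ d :=
  ρ.posSemidef.isHermitian.eigenvectorBasis y

/-- The von Neumann entropy `H(ρ) = -Tr (ρ log₂ ρ)`, in terms of the eigenvalues
(with `0 log 0 = 0`). -/
def entropy (ρ : DensityMatrix d) : ℝ :=
  -∑ y, ρ.eigenvalue y * Real.logb 2 (ρ.eigenvalue y)

/-- The average state `∑ₓ p(x) σₓ` of an ensemble. -/
def average {X : Type*} [Fintype X] (p : stdSimplex ℝ X) (σ : X → DensityMatrix d) :
    DensityMatrix d where
  val := ∑ x, ((p.1 x : ℝ) : ℂ) • (σ x).val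
  posSemidef := Matrix.posSemidef_sum _ fun x _ =>
    (σ x).posSemidef.smul (by exact_mod_cast p.2.1 x)
  trace_eq_one := by
    have h := p.2.2
    simp only [Matrix.trace_sum, Matrix.trace_smul, (σ _).trace_eq_one, smul_eq_mul, mul_one]
    exact_mod_cast h

end DensityMatrix

/-- The tensor product state `τ₁ ⊗ ⋯ ⊗ τₙ` on `(ℂ^d)^{⊗ n}`, whose standard basis is indexed by
`Fin n → d`. -/
def tensorState {n : ℕ} (τ : Fin n → DensityMatrix d) : Matrix (Fin n → d) (Fin n → d) ℂ :=
  Matrix.of fun z z' => ∏ i, (τ i).val (z i) (z' i)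

/-- The product vector `e_{y₁} ⊗ ⋯ ⊗ e_{yₙ}` of eigenvectors of `τ₁, …, τₙ`. -/
def productEigenvector {n : ℕ} (τ : Fin n → DensityMatrix d) (y : Fin n → d) :
    (Fin n → d) → ℂ :=
  fun z => ∏ i, (τ i).eigenvector (y i) (z i)

/-- The eigenvalue of `τ₁ ⊗ ⋯ ⊗ τₙ` belonging to `productEigenvector τ y`. -/
def productEigenvalue {n : ℕ} (τ : Fin n → DensityMatrix d) (y : Fin n → d) : ℝ :=
  ∏ i, (τ i).eigenvalue (y i)

/-- The index strings `y` with `|-(1/n) log₂ p(y) - h| ≤ η`, where `p(y)` is the eigenvalue of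
`τ₁ ⊗ ⋯ ⊗ τₙ`. The condition `0 < p(y)` excludes the strings with `-log₂ p(y) = ∞`. -/
def typicalStrings {n : ℕ} (τ : Fin n → DensityMatrix d) (h η : ℝ) : Set (Fin n → d) :=
  {y | 0 < productEigenvalue τ y ∧ |-Real.logb 2 (productEigenvalue τ y) / n - h| ≤ η}

open Classical in
/-- The projector onto the span of the product eigenvectors of `τ₁ ⊗ ⋯ ⊗ τₙ` indexed by
`typicalStrings τ h η`. -/
def entropyProjector {n : ℕ} (τ : Fin n → DensityMatrix d) (h η : ℝ) :
    Matrix (Fin n → d) (Fin n → d) ℂ :=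
  ∑ y ∈ Finset.univ.filter (· ∈ typicalStrings τ h η),
    Matrix.vecMulVec (productEigenvector τ y) (star (productEigenvector τ y))

/-- A finite family of operators is a POVM. -/
def IsPOVM {ι κ : Type*} [Fintype ι] [Fintype κ] [DecidableEq κ]
    (Λ : ι → Matrix κ κ ℂ) : Prop :=
  (∀ i, (Λ i).PosSemidef) ∧ ∑ i, Λ i = 1

/-- A family of operators, completed by the extra outcome `none` ("failure") with operator
`1 - ∑ Λᵢ`. -/
def withFailure {ι κ : Type*} [Fintype ι] [DecidableEq κ]
    (Λ : ι → Matrix κ κ ℂ) : Option ι → Matrix κ κ ℂ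
  | some i => Λ i
  | none => 1 - ∑ i, Λ i

/-- `A^{-1/2}` for a positive semidefinite `A`, the inverse being taken on the support of `A`:
the eigenvalue `0` is sent to `(√0)⁻¹ = 0`. -/
def invSqrt {κ : Type*} [Fintype κ] [DecidableEq κ] (A : Matrix κ κ ℂ) : Matrix κ κ ℂ :=
  cfc (fun t : ℝ => (√t)⁻¹) A

/-- The square-root measurement built from a family of positive semidefinite operators. -/
def squareRootMeasurement {ι κ : Type*} [Fintype ι] [Fintype κ] [DecidableEq κ]
    (P : ι → Matrix κ κ ℂ) (i : ι) : Matrix κ κ ℂ :=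
  invSqrt (∑ j, P j) * P i * invSqrt (∑ j, P j)

section Channel

/-! A classical-quantum multiple access channel is a family of states `W x₁ x₂`; the inputs are
distributed according to `p₁` and `p₂`, independently. -/

variable {X₁ X₂ : Type*} [Fintype X₁] [Fintype X₂]

/-- `ρ̄_{x₁} = ∑ p₂(x₂) ρ_{x₁,x₂}`. -/
def avgOver₂ (p₂ : stdSimplex ℝ X₂) (W : X₁ → X₂ → DensityMatrix d) (x₁ : X₁) :
    DensityMatrix d :=
  DensityMatrix.average p₂ (W x₁)

/-- `ρ̄_{x₂} = ∑ p₁(x₁) ρ_{x₁,x₂}`. -/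
def avgOver₁ (p₁ : stdSimplex ℝ X₁) (W : X₁ → X₂ → DensityMatrix d) (x₂ : X₂) :
    DensityMatrix d :=
  DensityMatrix.average p₁ fun x₁ => W x₁ x₂

/-- `ρ̄ = ∑ p₁(x₁) p₂(x₂) ρ_{x₁,x₂}`. -/
def avgState (p₁ : stdSimplex ℝ X₁) (p₂ : stdSimplex ℝ X₂) (W : X₁ → X₂ → DensityMatrix d) :
    DensityMatrix d :=
  DensityMatrix.average p₁ (avgOver₂ p₂ W)

/-- `H(B)`. -/
def entB (p₁ : stdSimplex ℝ X₁) (p₂ : stdSimplex ℝ X₂) (W : X₁ → X₂ → DensityMatrix d) : ℝ :=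
  (avgState p₁ p₂ W).entropy

/-- `H(B|X₁)`. -/
def entBgivenX₁ (p₁ : stdSimplex ℝ X₁) (p₂ : stdSimplex ℝ X₂)
    (W : X₁ → X₂ → DensityMatrix d) : ℝ :=
  ∑ x₁, p₁.1 x₁ * (avgOver₂ p₂ W x₁).entropy

/-- `H(B|X₂)`. -/
def entBgivenX₂ (p₁ : stdSimplex ℝ X₁) (p₂ : stdSimplex ℝ X₂)
    (W : X₁ → X₂ → DensityMatrix d) : ℝ :=
  ∑ x₂, p₂.1 x₂ * (avgOver₁ p₁ W x₂).entropy

/-- `H(B|X₁X₂)`. -/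
def entBgivenX₁X₂ (p₁ : stdSimplex ℝ X₁) (p₂ : stdSimplex ℝ X₂)
    (W : X₁ → X₂ → DensityMatrix d) : ℝ :=
  ∑ x₁, ∑ x₂, p₁.1 x₁ * p₂.1 x₂ * (W x₁ x₂).entropy

/-- `I(X₁;B|X₂) = H(B|X₂) - H(B|X₁X₂)`. -/
def infoX₁ (p₁ : stdSimplex ℝ X₁) (p₂ : stdSimplex ℝ X₂) (W : X₁ → X₂ → DensityMatrix d) : ℝ :=
  entBgivenX₂ p₁ p₂ W - entBgivenX₁X₂ p₁ p₂ W

/-- `I(X₂;B|X₁) = H(B|X₁) - H(B|X₁X₂)`. -/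
def infoX₂ (p₁ : stdSimplex ℝ X₁) (p₂ : stdSimplex ℝ X₂) (W : X₁ → X₂ → DensityMatrix d) : ℝ :=
  entBgivenX₁ p₁ p₂ W - entBgivenX₁X₂ p₁ p₂ W

/-- `I(X₁X₂;B) = H(B) - H(B|X₁X₂)`. -/
def infoX₁X₂ (p₁ : stdSimplex ℝ X₁) (p₂ : stdSimplex ℝ X₂)
    (W : X₁ → X₂ → DensityMatrix d) : ℝ :=
  entB p₁ p₂ W - entBgivenX₁X₂ p₁ p₂ W

/-- A codebook with `M` codewords of length `n`. -/
abbrev Codebook (X : Type*) (M n : ℕ) : Type _ := Fin M → Fin n → X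

/-- The probability of a codebook all of whose letters are drawn independently from `p`. -/
def codebookProb {X : Type*} [Fintype X] {M n : ℕ} (p : stdSimplex ℝ X) (c : Codebook X M n) :
    ℝ :=
  ∏ m, ∏ i, p.1 (c m i)

variable {M₁ M₂ n : ℕ}

/-- The output `ρ_{x₁ⁿ(m₁),x₂ⁿ(m₂)}` of `n` channel uses for the message pair `m = (m₁, m₂)`. -/
def outputState (W : X₁ → X₂ → DensityMatrix d) (c₁ : Codebook X₁ M₁ n) (c₂ : Codebook X₂ M₂ n)
    (m : Fin M₁ × Fin M₂) : Matrix (Fin n → d) (Fin n → d) ℂ :=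
  tensorState fun i => W (c₁ m.1 i) (c₂ m.2 i)

/-- The typical projector of `ρ̄^{⊗ n}`. -/
def typProj (p₁ : stdSimplex ℝ X₁) (p₂ : stdSimplex ℝ X₂) (W : X₁ → X₂ → DensityMatrix d)
    (n : ℕ) (η : ℝ) : Matrix (Fin n → d) (Fin n → d) ℂ :=
  entropyProjector (fun _ : Fin n => avgState p₁ p₂ W) (entB p₁ p₂ W) η

/-- The conditionally typical projector of `ρ̄_{x₁ⁿ}`. -/
def typProj₁ (p₁ : stdSimplex ℝ X₁) (p₂ : stdSimplex ℝ X₂) (W : X₁ → X₂ → DensityMatrix d)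
    (η : ℝ) (x₁ : Fin n → X₁) : Matrix (Fin n → d) (Fin n → d) ℂ :=
  entropyProjector (fun i => avgOver₂ p₂ W (x₁ i)) (entBgivenX₁ p₁ p₂ W) η

/-- The conditionally typical projector of `ρ_{x₁ⁿ,x₂ⁿ}`. -/
def typProj₁₂ (p₁ : stdSimplex ℝ X₁) (p₂ : stdSimplex ℝ X₂) (W : X₁ → X₂ → DensityMatrix d)
    (η : ℝ) (x₁ : Fin n → X₁) (x₂ : Fin n → X₂) : Matrix (Fin n → d) (Fin n → d) ℂ :=
  entropyProjector (fun i => W (x₁ i) (x₂ i)) (entBgivenX₁X₂ p₁ p₂ W) η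

/-- The sandwiched operator `Π Π_{m₁} Π_{m₁,m₂} Π_{m₁} Π`. -/
def sandwich (p₁ : stdSimplex ℝ X₁) (p₂ : stdSimplex ℝ X₂) (W : X₁ → X₂ → DensityMatrix d)
    (η : ℝ) (c₁ : Codebook X₁ M₁ n) (c₂ : Codebook X₂ M₂ n) (m : Fin M₁ × Fin M₂) :
    Matrix (Fin n → d) (Fin n → d) ℂ :=
  typProj p₁ p₂ W n η * typProj₁ p₁ p₂ W η (c₁ m.1) *
    typProj₁₂ p₁ p₂ W η (c₁ m.1) (c₂ m.2) *
    typProj₁ p₁ p₂ W η (c₁ m.1) * typProj p₁ p₂ W n η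

/-- The simultaneous decoder for a pair of codebooks: the square-root measurement of the sandwiched
operators. -/
def simultaneousDecoder (p₁ : stdSimplex ℝ X₁) (p₂ : stdSimplex ℝ X₂)
    (W : X₁ → X₂ → DensityMatrix d) (η : ℝ) (c₁ : Codebook X₁ M₁ n) (c₂ : Codebook X₂ M₂ n) :
    Fin M₁ × Fin M₂ → Matrix (Fin n → d) (Fin n → d) ℂ :=
  squareRootMeasurement (sandwich p₁ p₂ W η c₁ c₂)

/-- The average error probability `(1 / (M₁ M₂)) ∑ Tr ((1 - Λ_{m₁,m₂}) ρ_{m₁,m₂})` of a code. -/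
def averageError (W : X₁ → X₂ → DensityMatrix d) (c₁ : Codebook X₁ M₁ n) (c₂ : Codebook X₂ M₂ n)
    (Λ : Fin M₁ × Fin M₂ → Matrix (Fin n → d) (Fin n → d) ℂ) : ℝ :=
  1 / ((M₁ : ℝ) * (M₂ : ℝ)) * ∑ m, (((1 - Λ m) * outputState W c₁ c₂ m).trace).re

/-- The expectation of the average error probability over the two independent random codebooks,
when the measurement `Λ c₁ c₂` is used for the codebooks `c₁, c₂`. -/
def expectedAverageError (p₁ : stdSimplex ℝ X₁) (p₂ : stdSimplex ℝ X₂)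
    (W : X₁ → X₂ → DensityMatrix d)
    (Λ : Codebook X₁ M₁ n → Codebook X₂ M₂ n →
      Fin M₁ × Fin M₂ → Matrix (Fin n → d) (Fin n → d) ℂ) : ℝ :=
  ∑ c₁, ∑ c₂, codebookProb p₁ c₁ * codebookProb p₂ c₂ * averageError W c₁ c₂ (Λ c₁ c₂)

end Channel

end QuantumMAC

end

/-! The decoder contains no projector for the second sender alone; that projector enters only the
analysis, applied to the state. The operator inequality `A ≤ 2 P A P + 2 (1 - P)` for `0 ≤ A ≤ 1`
(`le_conj_proj`) inserts it around `1 - Λ`, and `conj_proj_le` removes it again from the terms where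
it is not wanted. Working with operator inequalities instead of trace distances keeps every loss
linear in the states, so that losses can be averaged over the codebooks.

For fixed codebooks, the Hayashi–Nagaoka inequality bounds the error by the losses at the four
projectors plus a sum over wrong message pairs of `Tr (S σ)`, where `S` is the sandwiched operator
of the wrong pair and `σ` is the transmitted state conjugated by the second sender's projector
(`error_le`). Averaging treats three kinds of wrong pair. If only the first message is wrong,
averaging `σ` over the true first codeword makes its spectrum small. If only the second is wrong,
averaging `S` over the wrong second codeword turns `P₁₂` into a multiple of a conditional average
state, which `P₁` bounds. If both are wrong, the second sender's projector is dropped and the outer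
`P` bounds the average state. Each kind contributes its number of pairs times `2^{n H(B|X₁X₂)}`
times `2^{-n H}`, with `H` equal to `H(B|X₂)`, `H(B|X₁)` or `H(B)` respectively, up to `η`; the rate
conditions make all three exponentially small because `2 η < δ`.

The typical windows are centred at entropies averaged over the input distributions, not at those of
the given codeword, so the eigenvalue bounds hold for every codeword. Atypical codewords appear only
in the expected losses, which Chebyshev's inequality bounds by `V / n`. -/

noncomputable section

namespace QuantumMAC

/-! ### Operator inequalities for projectors and conjugations. -/

section OperatorInequalities

open scoped MatrixOrder

variable {κ : Type*} [Fintype κ] [DecidableEq κ]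

/-- The square root is operator monotone. -/
lemma le_of_mul_self_le_mul_self {A B : Matrix κ κ ℂ} (hA : 0 ≤ A) (hB : 0 ≤ B)
    (h : A * A ≤ B * B) : A ≤ B := by
  open scoped Matrix.Norms.L2Operator in
  -- The L2 operator norm serves only to supply the C⋆-algebra structure required by the
  -- monotonicity of `CFC.sqrt`.
  let _ : CStarAlgebra (Matrix κ κ ℂ) := {}
  have := CFC.sqrt_le_sqrt _ _ h
  rwa [CFC.sqrt_mul_self A hA, CFC.sqrt_mul_self B hB] at this

lemma isHermitian_sub_one {R : Matrix κ κ ℂ} (hR : R.IsHermitian) : (R - 1).IsHermitian :=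
  hR.sub Matrix.isHermitian_one

/-- `Xᴴ A X` is monotone in `A`, for Hermitian `X`. -/
lemma conj_mono {A B X : Matrix κ κ ℂ} (hX : X.IsHermitian) (h : A ≤ B) :
    X * A * X ≤ X * B * X :=
  IsSelfAdjoint.conjugate_le_conjugate h hX

lemma conj_nonneg {A X : Matrix κ κ ℂ} (hX : X.IsHermitian) (h : 0 ≤ A) :
    0 ≤ X * A * X :=
  IsSelfAdjoint.conjugate_nonneg h hX

/-- The parallelogram inequality for the quadratic form `X ↦ X A X`. -/
lemma conj_add_le {A X Y : Matrix κ κ ℂ} (hX : X.IsHermitian) (hY : Y.IsHermitian)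
    (hA : 0 ≤ A) :
    (X + Y) * A * (X + Y) ≤ 2 • (X * A * X) + 2 • (Y * A * Y) := by
  have h := conj_nonneg (hX.sub hY) hA
  rw [← sub_nonneg]
  convert h using 1
  noncomm_ring

/-- Conjugation by a projector `P` loses little: `P A P ≤ 2 A + 2 (1 - P)` if `0 ≤ A ≤ 1`. -/
lemma conj_proj_le {A P : Matrix κ κ ℂ} (hP : P.IsHermitian) (hPP : P * P = P)
    (hA : 0 ≤ A) (hA1 : A ≤ 1) :
    P * A * P ≤ 2 • A + 2 • (1 - P) := by
  -- Write `P = 1 + (P - 1)`; the cross terms cost a factor 2.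
  have h := conj_add_le (X := 1) (Y := P - 1) Matrix.isHermitian_one (isHermitian_sub_one hP) hA
  have h2 : (P - 1) * A * (P - 1) ≤ 1 - P := by
    refine (conj_mono (isHermitian_sub_one hP) hA1).trans_eq ?_
    simp only [mul_one, mul_sub, sub_mul, hPP, one_mul]
    abel
  rw [add_sub_cancel, one_mul, mul_one] at h
  exact h.trans (by gcongr)

/-- The reverse estimate: `A ≤ 2 P A P + 2 (1 - P)` for a projector `P` and `0 ≤ A ≤ 1`. -/
lemma le_conj_proj {A P : Matrix κ κ ℂ} (hP : P.IsHermitian) (hPP : P * P = P)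
    (hA : 0 ≤ A) (hA1 : A ≤ 1) :
    A ≤ 2 • (P * A * P) + 2 • (1 - P) := by
  have h := conj_add_le (X := P) (Y := 1 - P) hP (Matrix.isHermitian_one.sub hP) hA
  have h2 : (1 - P) * A * (1 - P) ≤ 1 - P := by
    refine (conj_mono (Matrix.isHermitian_one.sub hP) hA1).trans_eq ?_
    simp only [mul_one, mul_sub, sub_mul, hPP, one_mul]
    abel
  rw [add_sub_cancel, one_mul, mul_one] at h
  exact h.trans (by gcongr)

lemma proj_nonneg {P : Matrix κ κ ℂ} (hP : P.IsHermitian) (hPP : P * P = P) : 0 ≤ P := by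
  have := conj_nonneg hP (zero_le_one (α := Matrix κ κ ℂ))
  rwa [mul_one, hPP] at this

lemma proj_le_one {P : Matrix κ κ ℂ} (hP : P.IsHermitian) (hPP : P * P = P) : P ≤ 1 := by
  rw [← sub_nonneg]
  refine proj_nonneg (Matrix.isHermitian_one.sub hP) ?_
  simp only [mul_one, mul_sub, sub_mul, hPP, one_mul]
  abel

lemma conj_proj_le_one {A P : Matrix κ κ ℂ} (hP : P.IsHermitian) (hPP : P * P = P)
    (hA : A ≤ 1) : P * A * P ≤ 1 :=
  (conj_mono hP hA).trans (by rw [mul_one, hPP]; exact proj_le_one hP hPP)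

/-- A sandwich of three projectors is close to `1` where each of the projectors is. -/
lemma one_sub_sandwich_le {P Q R : Matrix κ κ ℂ} (hP : P.IsHermitian) (hPP : P * P = P)
    (hQ : Q.IsHermitian) (hQQ : Q * Q = Q) (hR : R.IsHermitian) (hRR : R * R = R) :
    1 - P * Q * R * Q * P ≤ 5 • (1 - P) + 6 • (1 - Q) + 4 • (1 - R) := by
  have hQ0 : 0 ≤ 1 - Q := sub_nonneg.2 (proj_le_one hQ hQQ)
  have hR0 : 0 ≤ 1 - R := sub_nonneg.2 (proj_le_one hR hRR)
  have hQ1 : 1 - Q ≤ 1 := sub_le_self _ (proj_nonneg hQ hQQ)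
  have hR1 : 1 - R ≤ 1 := sub_le_self _ (proj_nonneg hR hRR)
  have h1 := conj_proj_le hP hPP hQ0 hQ1
  have h2 := conj_proj_le hQ hQQ hR0 hR1
  have h3 := conj_proj_le hP hPP (conj_nonneg hQ hR0) (conj_proj_le_one hQ hQQ hR1)
  -- Telescoping from the outside in. The coefficients are 1 + 2 + 2 for `P`, 2 + 4 for `Q` and 4
  -- for `R`, each removed conjugation costing a factor 2.
  calc 1 - P * Q * R * Q * P
      = (1 - P) + P * (1 - Q) * P + P * (Q * (1 - R) * Q) * P := by
        simp only [mul_sub, sub_mul, mul_one, hPP, hQQ, mul_assoc]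
        abel
    _ ≤ (1 - P) + (2 • (1 - Q) + 2 • (1 - P)) +
          (2 • (2 • (1 - R) + 2 • (1 - Q)) + 2 • (1 - P)) := by
        gcongr
        exact h3.trans (by gcongr)
    _ = _ := by abel

/-! ### Functional calculus and the Hayashi–Nagaoka inequality. -/

section SquareRoot

variable {A : Matrix κ κ ℂ}

/-- A matrix has finite spectrum, so even the discontinuous `t ↦ (√t)⁻¹` is admissible in the
functional calculus. -/
lemma continuousOn_spectrum (f : ℝ → ℝ) :
    ContinuousOn f (spectrum ℝ A) :=
  (Matrix.finite_real_spectrum (A := A)).continuousOn f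

lemma spectrum_nonneg (hA : 0 ≤ A) {t : ℝ} (ht : t ∈ spectrum ℝ A) : 0 ≤ t :=
  spectrum_nonneg_of_nonneg hA ht

lemma cfc_mul_cfc (f g : ℝ → ℝ) :
    cfc f A * cfc g A = cfc (fun t => f t * g t) A :=
  (cfc_mul f g A (continuousOn_spectrum f) (continuousOn_spectrum g)).symm

lemma isHermitian_cfc (f : ℝ → ℝ) : (cfc f A).IsHermitian :=
  cfc_predicate f A

/-- The projector onto the support of a positive semidefinite operator. -/
def supportProj (A : Matrix κ κ ℂ) : Matrix κ κ ℂ :=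
  cfc (fun t : ℝ => (√t)⁻¹ * √t) A

lemma isHermitian_invSqrt : (invSqrt A).IsHermitian := isHermitian_cfc _

lemma isHermitian_supportProj : (supportProj A).IsHermitian := isHermitian_cfc _

lemma supportProj_mul_self : supportProj A * supportProj A = supportProj A := by
  rw [supportProj, cfc_mul_cfc]
  congr 1
  ext t
  by_cases ht : √t = 0 <;> simp [ht]

lemma invSqrt_conj_self (hA : 0 ≤ A) : invSqrt A * A * invSqrt A = supportProj A := by
  have h : A.IsHermitian := (Matrix.nonneg_iff_posSemidef.1 hA).isHermitian
  conv_lhs => rw [invSqrt]; enter [1, 2]; rw [← cfc_id' ℝ A h.isSelfAdjoint]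
  rw [cfc_mul_cfc, cfc_mul_cfc, supportProj]
  refine cfc_congr fun t ht => ?_
  rcases (spectrum_nonneg hA ht).eq_or_lt with h0 | h0
  · simp [← h0]
  · have h1 : √t ≠ 0 := (Real.sqrt_pos.2 h0).ne'
    have h2 : √t * √t = t := Real.mul_self_sqrt h0.le
    nth_rewrite 2 [← h2]
    field_simp

/-- The scalar identity `((√t)⁻¹ - 1)² t = 1 - 2 √t + t` for `t > 0`, with both sides zero at `t =
0` once 1 is replaced by the support indicator. The term `-2 √t` is what makes Hayashi–Nagaoka work:
`√A` can be bounded below. -/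
lemma invSqrt_sub_one_conj (hA : 0 ≤ A) :
    (invSqrt A - 1) * A * (invSqrt A - 1) =
      supportProj A - 2 • cfc (fun t : ℝ => √t) A + A := by
  have h : A.IsHermitian := (Matrix.nonneg_iff_posSemidef.1 hA).isHermitian
  have h1 : ∀ t ∈ spectrum ℝ A, (√t)⁻¹ * t = √t := fun t ht => by
    rcases (spectrum_nonneg hA ht).eq_or_lt with h0 | h0
    · simp [← h0]
    · have h1 : √t ≠ 0 := (Real.sqrt_pos.2 h0).ne'
      have h2 : √t * √t = t := Real.mul_self_sqrt h0.le
      nth_rewrite 2 [← h2]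
      field_simp
  have h2 : invSqrt A * A = cfc (fun t : ℝ => √t) A := by
    conv_lhs => rw [invSqrt]; enter [2]; rw [← cfc_id' ℝ A h.isSelfAdjoint]
    rw [cfc_mul_cfc]
    exact cfc_congr h1
  have h3 : A * invSqrt A = cfc (fun t : ℝ => √t) A := by
    conv_lhs => rw [invSqrt]; enter [1]; rw [← cfc_id' ℝ A h.isSelfAdjoint]
    rw [cfc_mul_cfc]
    exact cfc_congr fun t ht => (mul_comm _ _).trans (h1 t ht)
  have h4 := invSqrt_conj_self hA
  rw [h2] at h4
  simp only [sub_mul, mul_sub, one_mul, mul_one, h2, h3, h4]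
  abel

/-- The Hayashi–Nagaoka operator inequality. -/
theorem hayashi_nagaoka {S T : Matrix κ κ ℂ} (hS : 0 ≤ S) (hS1 : S ≤ 1) (hT : 0 ≤ T) :
    1 - invSqrt (S + T) * S * invSqrt (S + T) ≤ 2 • (1 - S) + 4 • T := by
  have hA : 0 ≤ S + T := add_nonneg hS hT
  have h : (S + T).IsHermitian := (Matrix.nonneg_iff_posSemidef.1 hA).isHermitian
  have hSh : S.IsHermitian := (Matrix.nonneg_iff_posSemidef.1 hS).isHermitian
  set A := S + T with hAdef
  set R := invSqrt A with hRdef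
  set G := supportProj A
  set Q : Matrix κ κ ℂ := cfc (fun t : ℝ => √t) A with hQ
  have hGh : (1 - G).IsHermitian := Matrix.isHermitian_one.sub isHermitian_supportProj
  have hRh : R.IsHermitian := isHermitian_invSqrt
  have hSQ : S ≤ Q := by
    refine le_of_mul_self_le_mul_self hS (cfc_nonneg fun t _ => Real.sqrt_nonneg t) ?_
    have hQQ : Q * Q = A := by
      rw [hQ, cfc_mul_cfc]
      conv_rhs => rw [← cfc_id' ℝ A h.isSelfAdjoint]
      exact cfc_congr fun t ht => Real.mul_self_sqrt (spectrum_nonneg hA ht)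
    -- `S - S² = S (1 - S) S + (1 - S) S (1 - S)`; hence `S² ≤ S ≤ A = Q²`, and taking roots gives
    -- `S ≤ Q`.
    have hSS : S * S ≤ S := by
      have h0 := conj_nonneg hSh (sub_nonneg.2 hS1)
      have h1 := conj_nonneg (Matrix.isHermitian_one.sub hSh) hS
      rw [← sub_nonneg]
      convert add_nonneg h0 h1 using 1
      noncomm_ring
    rw [hQQ]
    exact hSS.trans (le_add_of_nonneg_right hT)
  have hTA : T ≤ A := le_add_of_nonneg_left hS
  -- Split `R = 1 + (R - 1)`. Enlarging `T` to `A` in the second term only leaves there a function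
  -- of `A` alone.
  have h1 : R * T * R ≤ 2 • T + 2 • ((R - 1) * A * (R - 1)) := by
    have := conj_add_le (X := 1) (Y := R - 1) Matrix.isHermitian_one
      (isHermitian_sub_one hRh) hT
    rw [add_sub_cancel, one_mul, mul_one] at this
    refine this.trans ?_
    gcongr
    exact conj_mono (isHermitian_sub_one hRh) hTA
  rw [invSqrt_sub_one_conj hA] at h1
  have h2 : R * S * R = G - R * T * R := by
    have h3 : R * A * R = G := invSqrt_conj_self hA
    rw [← h3, hAdef, mul_add, add_mul, add_sub_cancel_right]
  have hG1 : G ≤ 1 := proj_le_one isHermitian_supportProj (supportProj_mul_self)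
  calc 1 - R * S * R = (1 - G) + R * T * R := by rw [h2]; abel
    _ ≤ (1 - G) + (2 • T + 2 • (G - 2 • Q + A)) := by gcongr
    -- Doubling `1 - G` makes the support projector cancel in the next line.
    _ ≤ (2 • (1 - G)) + (2 • T + 2 • (G - 2 • S + A)) := by
        gcongr
        rw [two_nsmul]
        exact le_add_of_nonneg_left (sub_nonneg.2 hG1)
    _ = 2 • (1 - S) + 4 • T := by
        rw [hAdef]
        abel

end SquareRoot

/-! ### The square-root measurement. -/

section Measurement

variable {ι : Type*} [Fintype ι] {P : ι → Matrix κ κ ℂ}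

lemma squareRootMeasurement_nonneg (hP : ∀ i, 0 ≤ P i) (i : ι) :
    0 ≤ squareRootMeasurement P i :=
  conj_nonneg isHermitian_invSqrt (hP i)

/-- The sum is exactly the projector onto the support of `∑ P i`. -/
lemma sum_squareRootMeasurement_le_one (hP : ∀ i, 0 ≤ P i) :
    ∑ i, squareRootMeasurement P i ≤ 1 := by
  have hA : 0 ≤ ∑ i, P i := Finset.sum_nonneg fun i _ => hP i
  simp only [squareRootMeasurement]
  rw [← Finset.sum_mul, ← Finset.mul_sum, invSqrt_conj_self hA]
  exact proj_le_one isHermitian_supportProj (supportProj_mul_self)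

lemma squareRootMeasurement_le_one (hP : ∀ i, 0 ≤ P i) (i : ι) :
    squareRootMeasurement P i ≤ 1 :=
  (Finset.single_le_sum (fun j _ => squareRootMeasurement_nonneg hP j)
    (Finset.mem_univ i)).trans (sum_squareRootMeasurement_le_one hP)

lemma isPOVM_withFailure_squareRootMeasurement (hP : ∀ i, 0 ≤ P i) :
    IsPOVM (withFailure (squareRootMeasurement P)) := by
  refine ⟨fun i => ?_, ?_⟩
  · rw [← Matrix.nonneg_iff_posSemidef]
    cases i with
    | none => exact sub_nonneg.2 (sum_squareRootMeasurement_le_one hP)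
    | some i => exact squareRootMeasurement_nonneg hP i
  · simp [Fintype.sum_option, withFailure]

/-- The Hayashi–Nagaoka inequality for the square-root measurement. -/
lemma one_sub_squareRootMeasurement_le [DecidableEq ι] (hP : ∀ i, 0 ≤ P i)
    {i : ι} (hi : P i ≤ 1) :
    1 - squareRootMeasurement P i ≤
      2 • (1 - P i) + 4 • ∑ j ∈ Finset.univ.erase i, P j := by
  have h := hayashi_nagaoka (hP i) hi
    (Finset.sum_nonneg fun j (_ : j ∈ Finset.univ.erase i) => hP j)
  rwa [Finset.add_sum_erase _ _ (Finset.mem_univ i)] at h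

end Measurement

end OperatorInequalities

/-! ### Expectations over i.i.d. strings and Chebyshev's inequality. -/

section ProductDistributions

variable {ι X : Type*} [Fintype ι] [DecidableEq ι] [Fintype X]

lemma sum_pi_prod {R : Type*} [CommSemiring R] (u : ι → X → R) :
    ∑ c : ι → X, ∏ k, u k (c k) = ∏ k, ∑ x, u k x := by
  rw [Finset.prod_univ_sum, Fintype.piFinset_univ]

lemma sum_pi_prod_eq_one {p : X → ℝ} (hp : ∑ x, p x = 1) :
    ∑ c : ι → X, ∏ k, p (c k) = 1 := by
  rw [sum_pi_prod fun _ => p, hp, Finset.prod_const_one]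

/-- A function of one letter of an i.i.d. string. -/
lemma sum_pi_prod_mul_one {p : X → ℝ} (hp : ∑ x, p x = 1) (i : ι) (f : X → ℝ) :
    ∑ c : ι → X, (∏ k, p (c k)) * f (c i) = ∑ x, p x * f x := by
  have h := sum_pi_prod (ι := ι) fun k x => p x * (if k = i then f x else 1)
  simp only [Finset.prod_mul_distrib, Finset.prod_ite_eq', Finset.mem_univ, if_true] at h
  rw [h, Finset.prod_eq_single i]
  · simp
  · intro k _ hk
    simp [hk, hp]
  · simp

/-- The summand factorizes over the coordinates, and each coordinate other than `i`, `j` contributes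
the factor `∑ p = 1`. -/
lemma sum_pi_prod_mul_mul {p : X → ℝ} (hp : ∑ x, p x = 1) {i j : ι} (hij : i ≠ j)
    (f g : X → ℝ) :
    ∑ c : ι → X, (∏ k, p (c k)) * (f (c i) * g (c j)) =
      (∑ x, p x * f x) * ∑ x, p x * g x := by
  have h := sum_pi_prod (ι := ι) fun k x =>
    p x * ((if k = i then f x else 1) * (if k = j then g x else 1))
  simp only [Finset.prod_mul_distrib, Finset.prod_ite_eq', Finset.mem_univ, if_true] at h
  rw [h, ← Finset.mul_prod_erase _ _ (Finset.mem_univ i),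
    ← Finset.mul_prod_erase _ _ (Finset.mem_erase.2 ⟨hij.symm, Finset.mem_univ j⟩),
    Finset.prod_eq_one]
  · simp [hij, hij.symm]
  · intro k hk
    simp only [Finset.mem_erase, Finset.mem_univ, and_true] at hk
    simp [hk.1, hk.2, hp]

/-- A function of two distinct letters of an i.i.d. string. -/
lemma sum_pi_prod_mul_two {p : X → ℝ} (hp : ∑ x, p x = 1) {i j : ι} (hij : i ≠ j)
    (F : X → X → ℝ) :
    ∑ c : ι → X, (∏ k, p (c k)) * F (c i) (c j) = ∑ x, ∑ x', p x * (p x' * F x x') := by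
  classical
  -- Expanding `F` in products of indicators reduces to the factorized case.
  have hF : ∀ x x', F x x' =
      ∑ a, ∑ b, F a b * ((if x = a then 1 else 0) * (if x' = b then 1 else 0)) := by
    intro x x'
    simp
  calc ∑ c : ι → X, (∏ k, p (c k)) * F (c i) (c j)
      = ∑ a, ∑ b, F a b * ∑ c : ι → X, (∏ k, p (c k)) *
          ((if c i = a then 1 else 0) * (if c j = b then 1 else 0)) := by
        simp only [Finset.mul_sum]
        rw [Finset.sum_congr rfl fun a _ => Finset.sum_comm, Finset.sum_comm]
        refine Finset.sum_congr rfl fun c _ => ?_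
        rw [hF (c i) (c j), Finset.mul_sum]
        refine Finset.sum_congr rfl fun a _ => ?_
        rw [Finset.mul_sum]
        exact Finset.sum_congr rfl fun b _ => by ring
    _ = _ := by
        refine Finset.sum_congr rfl fun a _ => Finset.sum_congr rfl fun b _ => ?_
        rw [sum_pi_prod_mul_mul hp hij (fun x => if x = a then 1 else 0)
          (fun x => if x = b then 1 else 0)]
        simp
        ring

/-- Variances add: distinct coordinates are independent and `g` is centred, so only the diagonal
terms survive. -/
lemma sum_pi_prod_mul_sq {w : X → ℝ} (hw : ∑ x, w x = 1) {g : X → ℝ}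
    (hg : ∑ x, w x * g x = 0) :
    ∑ z : ι → X, (∏ k, w (z k)) * (∑ i, g (z i)) ^ 2 =
      Fintype.card ι * ∑ x, w x * g x ^ 2 := by
  calc ∑ z : ι → X, (∏ k, w (z k)) * (∑ i, g (z i)) ^ 2
      = ∑ i, ∑ j, ∑ z : ι → X, (∏ k, w (z k)) * (g (z i) * g (z j)) := by
        simp only [sq, Finset.sum_mul_sum]
        simp only [Finset.mul_sum]
        rw [Finset.sum_comm]
        exact Finset.sum_congr rfl fun i _ => Finset.sum_comm
    _ = ∑ i : ι, ∑ j : ι, if i = j then ∑ x, w x * g x ^ 2 else 0 := by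
        refine Finset.sum_congr rfl fun i _ => Finset.sum_congr rfl fun j _ => ?_
        split_ifs with hij
        · subst hij
          rw [sum_pi_prod_mul_one hw i fun x => g x * g x]
          simp only [sq]
        · rw [sum_pi_prod_mul_mul hw hij, hg, zero_mul]
    _ = _ := by simp

open Classical in
/-- Chebyshev's inequality for the empirical mean of an i.i.d. string. -/
theorem sum_pi_prod_deviation_le {w : X → ℝ} (hw0 : ∀ x, 0 ≤ w x) (hw : ∑ x, w x = 1)
    {f : X → ℝ} {h η : ℝ} (hf : ∑ x, w x * f x = h) (hη : 0 < η) {n : ℕ} (hn : 0 < n) :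
    ∑ z : Fin n → X, (if |(∑ i, f (z i)) / n - h| ≤ η then 0 else ∏ k, w (z k)) ≤
      (∑ x, w x * (f x - h) ^ 2) / (n * η ^ 2) := by
  have hn' : (0 : ℝ) < n := by exact_mod_cast hn
  have hg : ∑ x, w x * (f x - h) = 0 := by
    simp only [mul_sub, Finset.sum_sub_distrib, ← Finset.sum_mul, hf, hw]
    ring
  have h2 := sum_pi_prod_mul_sq (ι := Fin n) hw hg
  rw [Fintype.card_fin] at h2
  -- Markov's argument pointwise: outside the window, the squared centred sum is at least `(n η)²`.
  have key : ∀ z : Fin n → X,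
      (if |(∑ i, f (z i)) / n - h| ≤ η then 0 else ∏ k, w (z k)) ≤
        (∏ k, w (z k)) * (∑ i, (f (z i) - h)) ^ 2 / (n * η) ^ 2 := by
    intro z
    have hw1 : 0 ≤ ∏ k, w (z k) := Finset.prod_nonneg fun k _ => hw0 _
    split_ifs with hz
    · positivity
    · rw [le_div_iff₀ (by positivity)]
      refine mul_le_mul_of_nonneg_left ?_ hw1
      rw [sq_le_sq, abs_of_pos (by positivity)]
      have e : ∑ i, (f (z i) - h) = n * ((∑ i, f (z i)) / n - h) := by
        simp only [Finset.sum_sub_distrib, Finset.sum_const, Finset.card_univ, Fintype.card_fin,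
          nsmul_eq_mul]
        field_simp
      rw [e, abs_mul, abs_of_pos hn']
      exact mul_le_mul_of_nonneg_left (not_le.1 hz).le hn'.le
  refine (Finset.sum_le_sum fun z _ => key z).trans_eq ?_
  rw [← Finset.sum_div, h2]
  field_simp

end ProductDistributions

/-! ### Spectral calculus of product states and typical projectors. -/

section TypicalProjectors

open scoped MatrixOrder

variable {d : Type*} [Fintype d] [DecidableEq d]

namespace DensityMatrix

lemma eigenvalue_nonneg (ρ : DensityMatrix d) (y : d) : 0 ≤ ρ.eigenvalue y :=
  ρ.posSemidef.eigenvalues_nonneg y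

lemma sum_eigenvalue (ρ : DensityMatrix d) : ∑ y, ρ.eigenvalue y = 1 := by
  have h := ρ.posSemidef.isHermitian.trace_eq_sum_eigenvalues
  rw [ρ.trace_eq_one] at h
  have h' : ((∑ y, ρ.eigenvalue y : ℝ) : ℂ) = ((1 : ℝ) : ℂ) := by
    rw [Complex.ofReal_sum, Complex.ofReal_one, h]
    rfl
  exact_mod_cast h'

lemma sum_star_eigenvector_mul (ρ : DensityMatrix d) (y y' : d) :
    ∑ z, star (ρ.eigenvector y z) * ρ.eigenvector y' z = if y = y' then 1 else 0 := by
  have h := orthonormal_iff_ite.1 ρ.posSemidef.isHermitian.eigenvectorBasis.orthonormal y y'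
  rw [← h, PiLp.inner_apply]
  exact Finset.sum_congr rfl fun z _ => by rw [mul_comm]; rfl

lemma val_apply (ρ : DensityMatrix d) (a b : d) :
    ρ.val a b = ∑ y, ρ.eigenvector y a * (ρ.eigenvalue y : ℂ) * star (ρ.eigenvector y b) := by
  have h := ρ.posSemidef.isHermitian.spectral_theorem
  conv_lhs => rw [h]
  rw [Unitary.conjStarAlgAut_apply, Matrix.mul_apply]
  refine Finset.sum_congr rfl fun y _ => ?_
  rw [Matrix.mul_diagonal, Matrix.star_apply]
  rfl

end DensityMatrix

variable {n : ℕ} (τ : Fin n → DensityMatrix d)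

/-- The unitary whose columns are the product eigenvectors of `τ₁ ⊗ ⋯ ⊗ τₙ`. -/
def productBasis : Matrix (Fin n → d) (Fin n → d) ℂ :=
  Matrix.of fun z y => productEigenvector τ y z

lemma conjTranspose_productBasis_mul : (productBasis τ).conjTranspose * productBasis τ = 1 := by
  ext y y'
  simp only [Matrix.mul_apply, Matrix.conjTranspose_apply, productBasis, Matrix.of_apply,
    productEigenvector, star_prod, ← Finset.prod_mul_distrib]
  rw [sum_pi_prod fun i a => star ((τ i).eigenvector (y i) a) * (τ i).eigenvector (y' i) a]
  simp only [DensityMatrix.sum_star_eigenvector_mul, Matrix.one_apply]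
  by_cases h : y = y'
  · simp [h]
  · obtain ⟨i, hi⟩ := Function.ne_iff.1 h
    rw [if_neg h]
    exact Finset.prod_eq_zero (Finset.mem_univ i) (if_neg hi)

lemma productBasis_mul_conjTranspose : productBasis τ * (productBasis τ).conjTranspose = 1 :=
  mul_eq_one_comm.1 (conjTranspose_productBasis_mul τ)

/-- The operator that is diagonal in the product eigenbasis of `τ₁ ⊗ ⋯ ⊗ τₙ` with eigenvalues
`f`. -/
def spectralOp (f : (Fin n → d) → ℝ) : Matrix (Fin n → d) (Fin n → d) ℂ :=
  productBasis τ * Matrix.diagonal (fun y => (f y : ℂ)) * (productBasis τ).conjTranspose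

/-- A product state and its own typical projectors are diagonal in one basis. With `spectralOp_mono`
and `trace_spectralOp`, claims about them become pointwise claims about eigenvalues. -/
lemma spectralOp_mul (f g : (Fin n → d) → ℝ) :
    spectralOp τ f * spectralOp τ g = spectralOp τ fun y => f y * g y := by
  simp only [spectralOp, Complex.ofReal_mul, ← Matrix.diagonal_mul_diagonal]
  rw [show ∀ A B C D E : Matrix (Fin n → d) (Fin n → d) ℂ,
    A * B * C * (D * E * C) = A * B * (C * D) * E * C from fun _ _ _ _ _ => by
      simp only [mul_assoc], conjTranspose_productBasis_mul, mul_one]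
  simp only [mul_assoc]

lemma spectralOp_const (b : ℝ) : spectralOp τ (fun _ => b) = b • 1 := by
  have h : (Matrix.diagonal fun _ : Fin n → d => (b : ℂ)) = b • 1 := by
    rw [← Matrix.smul_one_eq_diagonal]
    ext
    simp [Matrix.one_apply]
  rw [spectralOp, h, mul_smul_comm, mul_one, smul_mul_assoc, productBasis_mul_conjTranspose]

lemma spectralOp_smul (b : ℝ) (f : (Fin n → d) → ℝ) :
    spectralOp τ (fun y => b * f y) = b • spectralOp τ f := by
  rw [← spectralOp_mul, spectralOp_const, smul_mul_assoc, one_mul]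

lemma spectralOp_sub (f g : (Fin n → d) → ℝ) :
    spectralOp τ f - spectralOp τ g = spectralOp τ fun y => f y - g y := by
  simp only [spectralOp, Complex.ofReal_sub, ← Matrix.diagonal_sub, mul_sub, sub_mul]

lemma isHermitian_spectralOp (f : (Fin n → d) → ℝ) : (spectralOp τ f).IsHermitian := by
  refine Matrix.isHermitian_mul_mul_conjTranspose _ ?_
  rw [Matrix.isHermitian_diagonal_iff]
  exact fun y => Complex.conj_ofReal _

lemma spectralOp_nonneg {f : (Fin n → d) → ℝ} (hf : ∀ y, 0 ≤ f y) : 0 ≤ spectralOp τ f := by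
  rw [Matrix.nonneg_iff_posSemidef]
  exact (Matrix.PosSemidef.diagonal fun y =>
    Complex.zero_le_real.2 (hf y)).mul_mul_conjTranspose_same _

lemma spectralOp_mono {f g : (Fin n → d) → ℝ} (h : ∀ y, f y ≤ g y) :
    spectralOp τ f ≤ spectralOp τ g := by
  rw [← sub_nonneg, spectralOp_sub]
  exact spectralOp_nonneg τ fun y => sub_nonneg.2 (h y)

lemma trace_spectralOp (f : (Fin n → d) → ℝ) :
    (spectralOp τ f).trace = ((∑ y, f y : ℝ) : ℂ) := by
  rw [spectralOp, Matrix.trace_mul_comm, ← mul_assoc, conjTranspose_productBasis_mul, one_mul,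
    Matrix.trace_diagonal, Complex.ofReal_sum]

lemma tensorState_eq_spectralOp : tensorState τ = spectralOp τ (productEigenvalue τ) := by
  ext z z'
  rw [spectralOp, Matrix.mul_apply]
  simp only [Matrix.mul_diagonal, Matrix.conjTranspose_apply, productBasis, Matrix.of_apply,
    tensorState, DensityMatrix.val_apply, productEigenvector, productEigenvalue, star_prod,
    Complex.ofReal_prod, ← Finset.prod_mul_distrib]
  rw [sum_pi_prod fun i y => (τ i).eigenvector y (z i) * ((τ i).eigenvalue y : ℂ) *
    star ((τ i).eigenvector y (z' i))]

open Classical in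
/-- The indicator function of the typical strings. -/
def typicalIndicator (h η : ℝ) (y : Fin n → d) : ℝ :=
  if y ∈ typicalStrings τ h η then 1 else 0

lemma entropyProjector_eq_spectralOp (h η : ℝ) :
    entropyProjector τ h η = spectralOp τ (typicalIndicator τ h η) := by
  classical
  ext z z'
  rw [spectralOp, Matrix.mul_apply]
  simp only [Matrix.mul_diagonal, Matrix.conjTranspose_apply, productBasis, Matrix.of_apply,
    entropyProjector, Matrix.sum_apply, Matrix.vecMulVec_apply, typicalIndicator,
    Finset.sum_filter]
  refine Finset.sum_congr rfl fun y _ => ?_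
  split_ifs <;> simp

lemma isHermitian_entropyProjector (h η : ℝ) : (entropyProjector τ h η).IsHermitian := by
  rw [entropyProjector_eq_spectralOp]
  exact isHermitian_spectralOp τ _

lemma entropyProjector_mul_self (h η : ℝ) :
    entropyProjector τ h η * entropyProjector τ h η = entropyProjector τ h η := by
  rw [entropyProjector_eq_spectralOp, spectralOp_mul]
  congr 1
  ext y
  simp [typicalIndicator]

lemma productEigenvalue_nonneg (y : Fin n → d) : 0 ≤ productEigenvalue τ y :=
  Finset.prod_nonneg fun i _ => (τ i).eigenvalue_nonneg _

lemma sum_productEigenvalue : ∑ y, productEigenvalue τ y = 1 := by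
  simp only [productEigenvalue]
  rw [sum_pi_prod fun i y => (τ i).eigenvalue y]
  simp [DensityMatrix.sum_eigenvalue]

lemma tensorState_nonneg : 0 ≤ tensorState τ := by
  rw [tensorState_eq_spectralOp]
  exact spectralOp_nonneg τ (productEigenvalue_nonneg τ)

lemma trace_tensorState : (tensorState τ).trace = 1 := by
  rw [tensorState_eq_spectralOp, trace_spectralOp, sum_productEigenvalue, Complex.ofReal_one]

variable {τ}

lemma productEigenvalue_le {h η : ℝ} (hn : 0 < n) {y : Fin n → d}
    (hy : y ∈ typicalStrings τ h η) : productEigenvalue τ y ≤ (2 : ℝ) ^ (-((n : ℝ) * (h - η))) := by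
  have hn' : (0 : ℝ) < n := by exact_mod_cast hn
  have h1 := (abs_le.1 hy.2).1
  rw [← Real.logb_le_iff_le_rpow one_lt_two hy.1]
  have h2 : h - η ≤ -Real.logb 2 (productEigenvalue τ y) / n := by linarith
  rw [le_div_iff₀ hn'] at h2
  linarith

lemma le_productEigenvalue {h η : ℝ} (hn : 0 < n) {y : Fin n → d}
    (hy : y ∈ typicalStrings τ h η) : (2 : ℝ) ^ (-((n : ℝ) * (h + η))) ≤ productEigenvalue τ y := by
  have hn' : (0 : ℝ) < n := by exact_mod_cast hn
  have h1 := (abs_le.1 hy.2).2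
  rw [← Real.le_logb_iff_rpow_le one_lt_two hy.1]
  have h2 : -Real.logb 2 (productEigenvalue τ y) / n ≤ h + η := by linarith
  rw [div_le_iff₀ hn'] at h2
  linarith

variable (τ)

/-- Source of both size bounds on a typical projector: read spectrally it gives the operator bound,
summed over `y` the trace bound. -/
lemma typicalIndicator_le {n : ℕ} (τ : Fin n → DensityMatrix d) (hn : 0 < n) (h η : ℝ)
    (y : Fin n → d) :
    typicalIndicator τ h η y ≤ (2 : ℝ) ^ ((n : ℝ) * (h + η)) * productEigenvalue τ y := by
  unfold typicalIndicator
  split_ifs with hy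
  · have h1 := le_productEigenvalue hn hy
    rwa [Real.rpow_neg zero_le_two, inv_le_iff_one_le_mul₀' (by positivity)] at h1
  · exact mul_nonneg (by positivity) (productEigenvalue_nonneg τ y)

/-- `Π ≤ 2^{n(h+η)} τ`. -/
lemma entropyProjector_le (hn : 0 < n) (h η : ℝ) :
    entropyProjector τ h η ≤ (2 : ℝ) ^ ((n : ℝ) * (h + η)) • tensorState τ := by
  rw [entropyProjector_eq_spectralOp, tensorState_eq_spectralOp, ← spectralOp_smul]
  exact spectralOp_mono τ (typicalIndicator_le τ hn h η)

/-- `Tr Π ≤ 2^{n(h+η)}`. -/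
lemma trace_entropyProjector_le (hn : 0 < n) (h η : ℝ) :
    (entropyProjector τ h η).trace.re ≤ (2 : ℝ) ^ ((n : ℝ) * (h + η)) := by
  rw [entropyProjector_eq_spectralOp, trace_spectralOp, Complex.ofReal_re]
  refine (Finset.sum_le_sum fun y _ => typicalIndicator_le τ hn h η y).trans_eq ?_
  rw [← Finset.mul_sum, sum_productEigenvalue, mul_one]

/-- `Π τ Π ≤ 2^{-n(h-η)}`. -/
lemma entropyProjector_conj_le (hn : 0 < n) (h η : ℝ) :
    entropyProjector τ h η * tensorState τ * entropyProjector τ h η ≤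
      (2 : ℝ) ^ (-((n : ℝ) * (h - η))) • 1 := by
  rw [entropyProjector_eq_spectralOp, tensorState_eq_spectralOp, spectralOp_mul, spectralOp_mul,
    ← spectralOp_const τ]
  refine spectralOp_mono τ fun y => ?_
  unfold typicalIndicator
  split_ifs with hy
  · simpa using productEigenvalue_le hn hy
  · simpa using (by positivity)

/-- `Π τ Π ≤ τ`. -/
lemma entropyProjector_conj_le_self (h η : ℝ) :
    entropyProjector τ h η * tensorState τ * entropyProjector τ h η ≤ tensorState τ := by
  rw [entropyProjector_eq_spectralOp, tensorState_eq_spectralOp, spectralOp_mul, spectralOp_mul]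
  refine spectralOp_mono τ fun y => ?_
  unfold typicalIndicator
  split_ifs with hy
  · simp
  · simpa using productEigenvalue_nonneg τ y

open Classical in
lemma trace_one_sub_entropyProjector_mul (h η : ℝ) :
    ((1 - entropyProjector τ h η) * tensorState τ).trace.re =
      ∑ y, if y ∈ typicalStrings τ h η then 0 else productEigenvalue τ y := by
  have h1 : (1 : Matrix (Fin n → d) (Fin n → d) ℂ) = spectralOp τ fun _ => 1 := by
    rw [spectralOp_const, one_smul]
  rw [h1, entropyProjector_eq_spectralOp, tensorState_eq_spectralOp, spectralOp_sub,
    spectralOp_mul, trace_spectralOp, Complex.ofReal_re]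
  refine Finset.sum_congr rfl fun y _ => ?_
  unfold typicalIndicator
  split_ifs <;> simp

/-- The typical projector captures all but `O(1/n)` of the state, on average over an i.i.d. string
of states. -/
theorem expected_atypical_le {X : Type*} [Fintype X] (p : X → ℝ) (hp0 : ∀ x, 0 ≤ p x)
    (hp : ∑ x, p x = 1) (σ : X → DensityMatrix d) {η : ℝ} (hη : 0 < η) :
    ∃ V : ℝ, ∀ n : ℕ, 0 < n →
      ∑ x : Fin n → X, (∏ i, p (x i)) *
        ((1 - entropyProjector (fun i => σ (x i)) (∑ x, p x * (σ x).entropy) η) *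
          tensorState fun i => σ (x i)).trace.re ≤ V / n := by
  classical
  set h := ∑ x, p x * (σ x).entropy with hh
  -- Drawing a letter and then an eigenvalue index of its state gives i.i.d. classical pairs; `f`
  -- has mean `h` under `w`, so the scalar Chebyshev bound applies with `V` equal to the variance
  -- over `η²`.
  let w : X × d → ℝ := fun a => p a.1 * (σ a.1).eigenvalue a.2
  let f : X × d → ℝ := fun a => -Real.logb 2 ((σ a.1).eigenvalue a.2)
  have hw0 : ∀ a, 0 ≤ w a := fun a => mul_nonneg (hp0 _) ((σ _).eigenvalue_nonneg _)
  have hw : ∑ a, w a = 1 := by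
    rw [Fintype.sum_prod_type]
    simp only [w, ← Finset.mul_sum, DensityMatrix.sum_eigenvalue, mul_one, hp]
  have hf : ∑ a, w a * f a = h := by
    rw [Fintype.sum_prod_type, hh]
    refine Finset.sum_congr rfl fun x _ => ?_
    simp only [w, f, DensityMatrix.entropy, mul_assoc, ← Finset.mul_sum, mul_neg,
      Finset.sum_neg_distrib]
  refine ⟨(∑ a, w a * (f a - h) ^ 2) / η ^ 2, fun n hn => ?_⟩
  have hn' : (n : ℝ) ≠ 0 := by exact_mod_cast hn.ne'
  refine le_trans ?_ ((sum_pi_prod_deviation_le hw0 hw hf hη hn).trans_eq (by field_simp))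
  rw [← (Equiv.arrowProdEquivProdArrow (Fin n) (fun _ => X) fun _ => d).symm.sum_comp,
    Fintype.sum_prod_type]
  refine Finset.sum_le_sum fun x _ => ?_
  rw [trace_one_sub_entropyProjector_mul, Finset.mul_sum]
  refine Finset.sum_le_sum fun y _ => ?_
  have hprod : ∏ i, w (x i, y i) = (∏ i, p (x i)) * productEigenvalue (fun i => σ (x i)) y :=
    Finset.prod_mul_distrib
  have e : ∀ i, (Equiv.arrowProdEquivProdArrow (Fin n) (fun _ => X) fun _ => d).symm (x, y) i =
      (x i, y i) := fun i => rfl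
  simp only [e]
  have hnn : 0 ≤ ∏ i, w (x i, y i) := Finset.prod_nonneg fun i _ => hw0 _
  rw [mul_ite, mul_zero, ← hprod]
  split_ifs with h1 h2 h2
  · exact le_rfl
  · exact hnn
  -- A string inside the window but not typical has weight zero: nonzero weight would make all
  -- eigenvalues nonzero, the logarithms would add, and the string would be typical. Thus the
  -- convention `logb 2 0 = 0` does no harm.
  · refine le_of_eq ?_
    by_contra hne
    refine h1 ⟨?_, ?_⟩
    · rw [hprod] at hne
      exact lt_of_le_of_ne (productEigenvalue_nonneg _ y) (right_ne_zero_of_mul hne).symm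
    · rw [hprod] at hne
      have hne' := right_ne_zero_of_mul hne
      rw [productEigenvalue, Finset.prod_ne_zero_iff] at hne'
      rwa [productEigenvalue, Real.logb_prod _ _ hne', ← Finset.sum_neg_distrib]
  · exact le_rfl

/-- Multilinearity of the tensor product together with independence of the letters. It identifies
the averages in the packing argument with product states. -/
lemma tensorState_average {X : Type*} [Fintype X] (p : stdSimplex ℝ X) {n : ℕ}
    (σ : Fin n → X → DensityMatrix d) :
    ∑ x : Fin n → X, (∏ i, p.1 (x i)) • tensorState (fun i => σ i (x i)) =
      tensorState fun i => DensityMatrix.average p (σ i) := by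
  ext z z'
  simp only [Matrix.sum_apply, Matrix.smul_apply, tensorState, Matrix.of_apply,
    DensityMatrix.average, Complex.real_smul, Complex.ofReal_prod, ← Finset.prod_mul_distrib,
    smul_eq_mul]
  rw [sum_pi_prod fun i x => ((p.1 x : ℝ) : ℂ) * (σ i x).val (z i) (z' i)]

end TypicalProjectors

/-! ### Trace pairing and the one-shot packing bound. -/

section OneShot

open scoped MatrixOrder

variable {κ : Type*} [Fintype κ]

/-- The real part of `Tr (A B)`. -/
def reTrace (A B : Matrix κ κ ℂ) : ℝ := (A * B).trace.re

lemma reTrace_comm (A B : Matrix κ κ ℂ) : reTrace A B = reTrace B A := by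
  rw [reTrace, Matrix.trace_mul_comm, reTrace]

lemma reTrace_add_left (A B C : Matrix κ κ ℂ) :
    reTrace (A + B) C = reTrace A C + reTrace B C := by
  simp [reTrace, add_mul]

lemma reTrace_sub_left (A B C : Matrix κ κ ℂ) :
    reTrace (A - B) C = reTrace A C - reTrace B C := by
  simp [reTrace, sub_mul]

lemma reTrace_sum_left {ι : Type*} (s : Finset ι) (A : ι → Matrix κ κ ℂ) (C : Matrix κ κ ℂ) :
    reTrace (∑ i ∈ s, A i) C = ∑ i ∈ s, reTrace (A i) C := by
  simp [reTrace, Finset.sum_mul, Matrix.trace_sum]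

lemma reTrace_sum_right {ι : Type*} (s : Finset ι) (A : Matrix κ κ ℂ) (C : ι → Matrix κ κ ℂ) :
    reTrace A (∑ i ∈ s, C i) = ∑ i ∈ s, reTrace A (C i) := by
  simp [reTrace, Finset.mul_sum, Matrix.trace_sum]

lemma reTrace_smul_left (r : ℝ) (A C : Matrix κ κ ℂ) :
    reTrace (r • A) C = r * reTrace A C := by
  simp [reTrace]

lemma reTrace_smul_right (r : ℝ) (A C : Matrix κ κ ℂ) :
    reTrace A (r • C) = r * reTrace A C := by
  simp [reTrace]

lemma reTrace_nsmul_left (r : ℕ) (A C : Matrix κ κ ℂ) :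
    reTrace (r • A) C = r * reTrace A C := by
  simp [reTrace]

lemma reTrace_conj (A B X : Matrix κ κ ℂ) :
    reTrace (X * A * X) B = reTrace A (X * B * X) := by
  simp only [reTrace]
  rw [mul_assoc, mul_assoc, Matrix.trace_mul_comm]
  simp only [mul_assoc]

variable [DecidableEq κ]

lemma reTrace_one_left (A : Matrix κ κ ℂ) : reTrace 1 A = A.trace.re := by
  rw [reTrace, one_mul]

lemma reTrace_nonneg {A B : Matrix κ κ ℂ} (hA : 0 ≤ A) (hB : 0 ≤ B) : 0 ≤ reTrace A B := by
  obtain ⟨C, rfl⟩ : ∃ C : Matrix κ κ ℂ, B = Matrix.conjTranspose C * C :=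
    CStarAlgebra.nonneg_iff_eq_star_mul_self.1 hB
  have h := ((Matrix.nonneg_iff_posSemidef.1 hA).mul_mul_conjTranspose_same C).trace_nonneg
  rw [reTrace, ← mul_assoc, Matrix.trace_mul_comm, ← mul_assoc]
  exact (Complex.le_def.1 h).1

lemma reTrace_mono_left {A B C : Matrix κ κ ℂ} (h : A ≤ B) (hC : 0 ≤ C) :
    reTrace A C ≤ reTrace B C := by
  rw [← sub_nonneg, ← reTrace_sub_left]
  exact reTrace_nonneg (sub_nonneg.2 h) hC

lemma reTrace_mono_right {A B C : Matrix κ κ ℂ} (h : A ≤ B) (hC : 0 ≤ C) :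
    reTrace C A ≤ reTrace C B := by
  rw [reTrace_comm C, reTrace_comm C]
  exact reTrace_mono_left h hC

lemma smul_mono_of_nonneg {r : ℝ} (hr : 0 ≤ r) {A B : Matrix κ κ ℂ} (h : A ≤ B) :
    r • A ≤ r • B := by
  rw [Matrix.le_iff, ← smul_sub]
  exact (Matrix.le_iff.1 h).smul hr

lemma sum_weighted_sum {ι U V : Type*} [Fintype U] [Fintype V] (s : Finset ι) (A : U → ℝ)
    (B : V → ℝ) (F : ι → U → V → ℝ) :
    ∑ i ∈ s, ∑ u, ∑ v, A u * (B v * F i u v) = ∑ u, ∑ v, A u * (B v * ∑ i ∈ s, F i u v) := by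
  rw [Finset.sum_comm]
  refine Finset.sum_congr rfl fun u _ => ?_
  rw [Finset.sum_comm]
  refine Finset.sum_congr rfl fun v _ => ?_
  rw [Finset.mul_sum, Finset.mul_sum]

/-- The data of the one-shot packing argument: a family of states `ρ x y` with independently
distributed `x`, `y`, a projector `P` for the average state, projectors `P₁ x` and `P₂ y` for the
conditional averages, and projectors `P₁₂ x y` for the states. -/
structure Packing (X Y κ : Type*) [Fintype X] [Fintype Y] [Fintype κ] [DecidableEq κ] where
  p : X → ℝ
  q : Y → ℝ
  p_nonneg : ∀ x, 0 ≤ p x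
  q_nonneg : ∀ y, 0 ≤ q y
  sum_p : ∑ x, p x = 1
  sum_q : ∑ y, q y = 1
  ρ : X → Y → Matrix κ κ ℂ
  ρ_nonneg : ∀ x y, 0 ≤ ρ x y
  trace_ρ : ∀ x y, (ρ x y).trace = 1
  P : Matrix κ κ ℂ
  P₁ : X → Matrix κ κ ℂ
  P₂ : Y → Matrix κ κ ℂ
  P₁₂ : X → Y → Matrix κ κ ℂ
  P_herm : P.IsHermitian
  P₁_herm : ∀ x, (P₁ x).IsHermitian
  P₂_herm : ∀ y, (P₂ y).IsHermitian
  P₁₂_herm : ∀ x y, (P₁₂ x y).IsHermitian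
  P_idem : P * P = P
  P₁_idem : ∀ x, P₁ x * P₁ x = P₁ x
  P₂_idem : ∀ y, P₂ y * P₂ y = P₂ y
  P₁₂_idem : ∀ x y, P₁₂ x y * P₁₂ x y = P₁₂ x y

namespace Packing

variable {X Y : Type*} [Fintype X] [Fintype Y] (D : Packing X Y κ)

/-- The state averaged over `y`. -/
def ρ₁ (x : X) : Matrix κ κ ℂ := ∑ y, D.q y • D.ρ x y

/-- The state averaged over `x`. -/
def ρ₂ (y : Y) : Matrix κ κ ℂ := ∑ x, D.p x • D.ρ x y

/-- The average state. -/
def ρ₀ : Matrix κ κ ℂ := ∑ x, D.p x • D.ρ₁ x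

/-- The sandwiched projectors from which the decoder is built. -/
def S (x : X) (y : Y) : Matrix κ κ ℂ := D.P * D.P₁ x * D.P₁₂ x y * D.P₁ x * D.P

/-- The state `ρ x y`, sandwiched by `P₂ y`. -/
def σ (x : X) (y : Y) : Matrix κ κ ℂ := D.P₂ y * D.ρ x y * D.P₂ y

/-- `a` bounds the sizes of the projectors `P₁₂ x y`, and `b₀`, `b₁`, `b₂` bound the eigenvalues of
the average states on the respective projectors. -/
structure IsBounded (a b₀ b₁ b₂ : ℝ) : Prop where
  a_nonneg : 0 ≤ a
  b₀_nonneg : 0 ≤ b₀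
  b₁_nonneg : 0 ≤ b₁
  b₂_nonneg : 0 ≤ b₂
  P_conj_le : D.P * D.ρ₀ * D.P ≤ b₀ • 1
  P₁_conj_le : ∀ x, D.P₁ x * D.ρ₁ x * D.P₁ x ≤ b₁ • 1
  P₂_conj_le : ∀ y, D.P₂ y * D.ρ₂ y * D.P₂ y ≤ b₂ • 1
  P₂_conj_le_self : ∀ y, D.P₂ y * D.ρ₂ y * D.P₂ y ≤ D.ρ₂ y
  P₁₂_le : ∀ x y, D.P₁₂ x y ≤ a • D.ρ x y
  trace_P₁₂_le : ∀ x y, (D.P₁₂ x y).trace.re ≤ a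

lemma S_eq (x : X) (y : Y) :
    D.S x y = D.P * (D.P₁ x * D.P₁₂ x y * D.P₁ x) * D.P := by
  simp only [S, mul_assoc]

lemma P₁₂_conj_nonneg (x : X) (y : Y) : 0 ≤ D.P₁ x * D.P₁₂ x y * D.P₁ x :=
  conj_nonneg (D.P₁_herm x) (proj_nonneg (D.P₁₂_herm x y) (D.P₁₂_idem x y))

lemma S_nonneg (x : X) (y : Y) : 0 ≤ D.S x y := by
  rw [S_eq]
  exact conj_nonneg D.P_herm (D.P₁₂_conj_nonneg x y)

lemma S_le_one (x : X) (y : Y) : D.S x y ≤ 1 := by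
  rw [S_eq]
  exact conj_proj_le_one D.P_herm D.P_idem (conj_proj_le_one (D.P₁_herm x) (D.P₁_idem x)
    (proj_le_one (D.P₁₂_herm x y) (D.P₁₂_idem x y)))

lemma σ_nonneg (x : X) (y : Y) : 0 ≤ D.σ x y :=
  conj_nonneg (D.P₂_herm y) (D.ρ_nonneg x y)

/-- Both orders of averaging are needed: `P₂ y` meets the state after the average over `x` but
before that over `y`. -/
lemma ρ₀_eq : D.ρ₀ = ∑ y, D.q y • D.ρ₂ y := by
  simp only [ρ₀, ρ₁, ρ₂, Finset.smul_sum]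
  rw [Finset.sum_comm]
  exact Finset.sum_congr rfl fun y _ => Finset.sum_congr rfl fun x _ => smul_comm _ _ _

lemma sum_σ (y : Y) : ∑ x, D.p x • D.σ x y = D.P₂ y * D.ρ₂ y * D.P₂ y := by
  simp only [σ, ρ₂, Finset.mul_sum, Finset.sum_mul, mul_smul_comm, smul_mul_assoc]

/-! ### Average overlap of a wrong pair with the transmitted state. -/

variable {D} {a b₀ b₁ b₂ : ℝ}

lemma trace_P₁₂_conj_le (h : D.IsBounded a b₀ b₁ b₂) (x : X) (y : Y) :
    (D.P₁ x * D.P₁₂ x y * D.P₁ x).trace.re ≤ a := by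
  refine le_trans ?_ (h.trace_P₁₂_le x y)
  rw [mul_assoc, Matrix.trace_mul_comm, mul_assoc, D.P₁_idem]
  have h1 := reTrace_mono_right (proj_le_one (D.P₁_herm x) (D.P₁_idem x))
    (proj_nonneg (D.P₁₂_herm x y) (D.P₁₂_idem x y))
  simpa only [reTrace, mul_one] using h1

lemma trace_S_le (h : D.IsBounded a b₀ b₁ b₂) (x : X) (y : Y) : (D.S x y).trace.re ≤ a := by
  refine le_trans ?_ (trace_P₁₂_conj_le h x y)
  rw [S_eq, mul_assoc, Matrix.trace_mul_comm, mul_assoc, D.P_idem]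
  have h1 := reTrace_mono_right (proj_le_one D.P_herm D.P_idem) (D.P₁₂_conj_nonneg x y)
  simpa only [reTrace, mul_one] using h1

/-- The first message is wrong: `x'` is independent of `x`. -/
lemma collision₁ (h : D.IsBounded a b₀ b₁ b₂) (x' : X) (y' y : Y) :
    ∑ x, D.p x * reTrace (D.S x' y') (D.σ x y) ≤ a * b₂ := by
  calc ∑ x, D.p x * reTrace (D.S x' y') (D.σ x y)
      -- Only the state depends on `x`. This is the one collision bound for which conjugating the
      -- state by `P₂` is essential.
      = reTrace (D.S x' y') (D.P₂ y * D.ρ₂ y * D.P₂ y) := by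
        rw [← sum_σ, reTrace_sum_right]
        simp only [reTrace_smul_right]
    _ ≤ reTrace (D.S x' y') (b₂ • 1) :=
        reTrace_mono_right (h.P₂_conj_le y) (D.S_nonneg x' y')
    _ = b₂ * (D.S x' y').trace.re := by rw [reTrace_smul_right, reTrace_comm, reTrace_one_left]
    _ ≤ b₂ * a := mul_le_mul_of_nonneg_left (trace_S_le h x' y') h.b₂_nonneg
    _ = a * b₂ := mul_comm _ _

/-- The second message is wrong: `y'` is independent of `y`. -/
lemma collision₂ (h : D.IsBounded a b₀ b₁ b₂) (x' x : X) (y : Y) :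
    ∑ y', D.q y' * reTrace (D.S x' y') (D.σ x y) ≤ a * b₁ := by
  -- Here the average acts on the decoder operator. Replacing each `P₁₂` by `a • ρ` turns it into an
  -- average state, whose spectrum the adjacent `P₁` cuts off at `b₁`.
  have h1 : ∑ y', D.q y' • D.P₁₂ x' y' ≤ a • D.ρ₁ x' := by
    rw [ρ₁, Finset.smul_sum]
    refine Finset.sum_le_sum fun y' _ => ?_
    rw [smul_comm]
    exact smul_mono_of_nonneg (D.q_nonneg y') (h.P₁₂_le x' y')
  have h2 : ∑ y', D.q y' • D.S x' y' ≤ (a * b₁) • 1 := by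
    calc ∑ y', D.q y' • D.S x' y'
        = D.P * (D.P₁ x' * (∑ y', D.q y' • D.P₁₂ x' y') * D.P₁ x') * D.P := by
          simp only [S_eq, Finset.mul_sum, Finset.sum_mul, mul_smul_comm, smul_mul_assoc]
      _ ≤ D.P * (D.P₁ x' * (a • D.ρ₁ x') * D.P₁ x') * D.P :=
          conj_mono D.P_herm (conj_mono (D.P₁_herm x') h1)
      _ ≤ D.P * (a • (b₁ • 1)) * D.P := by
          refine conj_mono D.P_herm ?_
          rw [mul_smul_comm, smul_mul_assoc]
          exact smul_mono_of_nonneg h.a_nonneg (h.P₁_conj_le x')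
      _ = (a * b₁) • D.P := by
          rw [smul_smul, mul_smul_comm, smul_mul_assoc, mul_one, D.P_idem]
      _ ≤ (a * b₁) • 1 :=
          smul_mono_of_nonneg (mul_nonneg h.a_nonneg h.b₁_nonneg)
            (proj_le_one D.P_herm D.P_idem)
  have h3 : (D.σ x y).trace.re ≤ 1 := by
    have h4 : (D.σ x y).trace.re = reTrace (D.P₂ y) (D.ρ x y) := by
      rw [σ, mul_assoc, Matrix.trace_mul_comm, mul_assoc, D.P₂_idem, reTrace,
        Matrix.trace_mul_comm]
    rw [h4]
    refine (reTrace_mono_left (proj_le_one (D.P₂_herm y) (D.P₂_idem y))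
      (D.ρ_nonneg x y)).trans_eq ?_
    rw [reTrace_one_left, D.trace_ρ, Complex.one_re]
  calc ∑ y', D.q y' * reTrace (D.S x' y') (D.σ x y)
      = reTrace (∑ y', D.q y' • D.S x' y') (D.σ x y) := by
        simp only [reTrace_sum_left, reTrace_smul_left]
    _ ≤ reTrace ((a * b₁) • 1) (D.σ x y) := reTrace_mono_left h2 (D.σ_nonneg x y)
    _ = (a * b₁) * (D.σ x y).trace.re := by rw [reTrace_smul_left, reTrace_one_left]
    _ ≤ a * b₁ := mul_le_of_le_one_right (mul_nonneg h.a_nonneg h.b₁_nonneg) h3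

/-- Both messages are wrong. -/
lemma collision₁₂ (h : D.IsBounded a b₀ b₁ b₂) (x' : X) (y' : Y) :
    ∑ y, D.q y * ∑ x, D.p x * reTrace (D.S x' y') (D.σ x y) ≤ a * b₀ := by
  -- `P₂` is discarded only after averaging over `x`, by `P₂_conj_le_self`; it need not be
  -- compatible with the individual states. Then the outer `P` of `S` meets `ρ₀`.
  have h1 : ∑ y, D.q y • ∑ x, D.p x • D.σ x y ≤ D.ρ₀ := by
    rw [ρ₀_eq]
    refine Finset.sum_le_sum fun y _ => ?_
    rw [sum_σ]
    exact smul_mono_of_nonneg (D.q_nonneg y) (h.P₂_conj_le_self y)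
  calc ∑ y, D.q y * ∑ x, D.p x * reTrace (D.S x' y') (D.σ x y)
      = reTrace (D.S x' y') (∑ y, D.q y • ∑ x, D.p x • D.σ x y) := by
        simp only [reTrace_sum_right, reTrace_smul_right]
    _ ≤ reTrace (D.S x' y') D.ρ₀ := reTrace_mono_right h1 (D.S_nonneg x' y')
    _ = reTrace (D.P₁ x' * D.P₁₂ x' y' * D.P₁ x') (D.P * D.ρ₀ * D.P) := by
        rw [S_eq, reTrace_conj]
    _ ≤ reTrace (D.P₁ x' * D.P₁₂ x' y' * D.P₁ x') (b₀ • 1) :=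
        reTrace_mono_right h.P_conj_le (D.P₁₂_conj_nonneg x' y')
    _ = b₀ * (D.P₁ x' * D.P₁₂ x' y' * D.P₁ x').trace.re := by
        rw [reTrace_smul_right, reTrace_comm, reTrace_one_left]
    _ ≤ b₀ * a := mul_le_mul_of_nonneg_left (trace_P₁₂_conj_le h x' y') h.b₀_nonneg
    _ = a * b₀ := mul_comm _ _

/-! ### Losses at the projectors. -/

variable (D)

/-- The expected losses caused by the four kinds of projectors are at most `ε`. -/
structure IsTypical (ε : ℝ) : Prop where
  loss₀ : reTrace (1 - D.P) D.ρ₀ ≤ ε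
  loss₁ : ∑ x, D.p x * reTrace (1 - D.P₁ x) (D.ρ₁ x) ≤ ε
  loss₂ : ∑ y, D.q y * reTrace (1 - D.P₂ y) (D.ρ₂ y) ≤ ε
  loss₁₂ : ∑ x, ∑ y, D.p x * (D.q y * reTrace (1 - D.P₁₂ x y) (D.ρ x y)) ≤ ε

/-- The total loss of the state `ρ x y` at the projectors, weighted as in the error bound. -/
def loss (x : X) (y : Y) : ℝ :=
  40 * reTrace (1 - D.P) (D.ρ x y) + 48 * reTrace (1 - D.P₁ x) (D.ρ x y) +
    32 * reTrace (1 - D.P₁₂ x y) (D.ρ x y) + 122 * reTrace (1 - D.P₂ y) (D.ρ x y)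

variable {D}

/-- Each loss is linear in the state, so averaging over the letters absent from its projector
produces `ρ₀`, `ρ₁` or `ρ₂`. The constant is 242 = 40 + 48 + 32 + 122. -/
lemma expected_loss_le {ε : ℝ} (h : D.IsTypical ε) :
    ∑ x, ∑ y, D.p x * (D.q y * D.loss x y) ≤ 242 * ε := by
  have h0 : ∑ x, ∑ y, D.p x * (D.q y * reTrace (1 - D.P) (D.ρ x y)) ≤ ε := by
    refine le_of_eq_of_le ?_ h.loss₀
    simp only [ρ₀, ρ₁, reTrace_sum_right, reTrace_smul_right, Finset.mul_sum]
  have h1 : ∑ x, ∑ y, D.p x * (D.q y * reTrace (1 - D.P₁ x) (D.ρ x y)) ≤ ε := by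
    refine le_of_eq_of_le ?_ h.loss₁
    simp only [ρ₁, reTrace_sum_right, reTrace_smul_right, Finset.mul_sum]
  have h2 : ∑ x, ∑ y, D.p x * (D.q y * reTrace (1 - D.P₂ y) (D.ρ x y)) ≤ ε := by
    refine le_of_eq_of_le ?_ h.loss₂
    simp only [ρ₂, reTrace_sum_right, reTrace_smul_right, Finset.mul_sum]
    rw [Finset.sum_comm]
    exact Finset.sum_congr rfl fun y _ => Finset.sum_congr rfl fun x _ => by ring
  have e : ∑ x, ∑ y, D.p x * (D.q y * D.loss x y) =
      40 * (∑ x, ∑ y, D.p x * (D.q y * reTrace (1 - D.P) (D.ρ x y))) +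
      48 * (∑ x, ∑ y, D.p x * (D.q y * reTrace (1 - D.P₁ x) (D.ρ x y))) +
      32 * (∑ x, ∑ y, D.p x * (D.q y * reTrace (1 - D.P₁₂ x y) (D.ρ x y))) +
      122 * (∑ x, ∑ y, D.p x * (D.q y * reTrace (1 - D.P₂ y) (D.ρ x y))) := by
    simp only [Finset.mul_sum, ← Finset.sum_add_distrib]
    exact Finset.sum_congr rfl fun x _ => Finset.sum_congr rfl fun y _ => by
      rw [loss]
      ring
  linarith [h.loss₁₂]

/-! ### Error for fixed codebooks and the random-coding average. -/

variable {M₁ M₂ : ℕ}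

/-- The error of the square-root measurement for given codebooks. -/
lemma error_le (c₁ : Fin M₁ → X) (c₂ : Fin M₂ → Y) (m : Fin M₁ × Fin M₂) :
    reTrace (1 - squareRootMeasurement (fun m' : Fin M₁ × Fin M₂ => D.S (c₁ m'.1) (c₂ m'.2)) m)
        (D.ρ (c₁ m.1) (c₂ m.2)) ≤
      D.loss (c₁ m.1) (c₂ m.2) + 8 * ∑ m' ∈ Finset.univ.erase m,
        reTrace (D.S (c₁ m'.1) (c₂ m'.2)) (D.σ (c₁ m.1) (c₂ m.2)) := by
  set T : Fin M₁ × Fin M₂ → Matrix κ κ ℂ := fun m' => D.S (c₁ m'.1) (c₂ m'.2) with hT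
  set Λ := squareRootMeasurement T m
  set x := c₁ m.1
  set y := c₂ m.2
  have hT0 : ∀ m', 0 ≤ T m' := fun m' => D.S_nonneg _ _
  have hP₂ := D.P₂_herm y
  have hQ : ∀ {Q : Matrix κ κ ℂ}, Q.IsHermitian → Q * Q = Q →
      D.P₂ y * (1 - Q) * D.P₂ y ≤ 2 • (1 - Q) + 2 • (1 - D.P₂ y) := fun h1 h2 =>
    conj_proj_le hP₂ (D.P₂_idem y) (sub_nonneg.2 (proj_le_one h1 h2))
      (sub_le_self _ (proj_nonneg h1 h2))
  have hΛ0 : 0 ≤ 1 - Λ := sub_nonneg.2 (squareRootMeasurement_le_one hT0 m)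
  have hΛ1 : 1 - Λ ≤ 1 := sub_le_self _ (squareRootMeasurement_nonneg hT0 m)
  have key : 1 - Λ ≤ 40 • (1 - D.P) + 48 • (1 - D.P₁ x) + 32 • (1 - D.P₁₂ x y) +
      122 • (1 - D.P₂ y) +
      8 • (D.P₂ y * (∑ m' ∈ Finset.univ.erase m, T m') * D.P₂ y) := by
    -- Inserting `P₂`, Hayashi–Nagaoka and the sandwich bound give the weights 20, 24, 16 and 8.
    -- Removing `P₂` from the first three terms doubles them and raises the weight of `1 - P₂` to 2
    -- + 2 (20 + 24 + 16) = 122. It stays around the wrong pairs.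
    calc 1 - Λ ≤ 2 • (D.P₂ y * (1 - Λ) * D.P₂ y) + 2 • (1 - D.P₂ y) :=
          le_conj_proj hP₂ (D.P₂_idem y) hΛ0 hΛ1
      _ ≤ 2 • (D.P₂ y * (2 • (5 • (1 - D.P) + 6 • (1 - D.P₁ x) + 4 • (1 - D.P₁₂ x y)) +
            4 • ∑ m' ∈ Finset.univ.erase m, T m') * D.P₂ y) + 2 • (1 - D.P₂ y) := by
          gcongr
          refine conj_mono hP₂ ((one_sub_squareRootMeasurement_le hT0 (D.S_le_one _ _)).trans ?_)
          gcongr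
          exact one_sub_sandwich_le D.P_herm D.P_idem (D.P₁_herm x) (D.P₁_idem x)
            (D.P₁₂_herm x y) (D.P₁₂_idem x y)
      _ = 20 • (D.P₂ y * (1 - D.P) * D.P₂ y) + 24 • (D.P₂ y * (1 - D.P₁ x) * D.P₂ y) +
            16 • (D.P₂ y * (1 - D.P₁₂ x y) * D.P₂ y) +
            8 • (D.P₂ y * (∑ m' ∈ Finset.univ.erase m, T m') * D.P₂ y) +
            2 • (1 - D.P₂ y) := by
          simp only [mul_add, add_mul, mul_smul_comm, smul_mul_assoc, smul_add, smul_smul,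
            Nat.reduceMul]
      _ ≤ 20 • (2 • (1 - D.P) + 2 • (1 - D.P₂ y)) + 24 • (2 • (1 - D.P₁ x) + 2 • (1 - D.P₂ y)) +
            16 • (2 • (1 - D.P₁₂ x y) + 2 • (1 - D.P₂ y)) +
            8 • (D.P₂ y * (∑ m' ∈ Finset.univ.erase m, T m') * D.P₂ y) +
            2 • (1 - D.P₂ y) := by
          gcongr
          · exact hQ D.P_herm D.P_idem
          · exact hQ (D.P₁_herm x) (D.P₁_idem x)
          · exact hQ (D.P₁₂_herm x y) (D.P₁₂_idem x y)
      _ = _ := by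
          generalize D.P₂ y * (∑ m' ∈ Finset.univ.erase m, T m') * D.P₂ y = Z
          abel
  refine (reTrace_mono_left key (D.ρ_nonneg x y)).trans_eq ?_
  -- Cyclicity (`reTrace_conj`) moves the remaining `P₂` onto the state, which produces `σ`.
  simp only [reTrace_add_left, reTrace_nsmul_left, reTrace_conj, reTrace_sum_left]
  rw [loss, σ]
  push_cast
  rfl

lemma sum_weights_mul_le {Z : Type*} [Fintype Z] {r : Z → ℝ} (hr0 : ∀ z, 0 ≤ r z)
    (hr : ∑ z, r z = 1) {f : Z → ℝ} {b : ℝ} (hf : ∀ z, f z ≤ b) : ∑ z, r z * f z ≤ b := by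
  refine (Finset.sum_le_sum fun z _ => mul_le_mul_of_nonneg_left (hf z) (hr0 z)).trans_eq ?_
  rw [← Finset.sum_mul, hr, one_mul]

/-- The expected contribution of a wrong pair of messages. -/
lemma expected_collision_le (h : D.IsBounded a b₀ b₁ b₂) {m m' : Fin M₁ × Fin M₂} (hm : m' ≠ m) :
    ∑ c₁ : Fin M₁ → X, ∑ c₂ : Fin M₂ → Y, (∏ k, D.p (c₁ k)) * ((∏ k, D.q (c₂ k)) *
        reTrace (D.S (c₁ m'.1) (c₂ m'.2)) (D.σ (c₁ m.1) (c₂ m.2))) ≤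
      if m'.1 = m.1 then a * b₁ else if m'.2 = m.2 then a * b₂ else a * b₀ := by
  have hp0 : ∀ c : Fin M₁ → X, 0 ≤ ∏ k, D.p (c k) := fun c =>
    Finset.prod_nonneg fun k _ => D.p_nonneg _
  have hq0 : ∀ c : Fin M₂ → Y, 0 ≤ ∏ k, D.q (c k) := fun c =>
    Finset.prod_nonneg fun k _ => D.q_nonneg _
  have hp1 := sum_pi_prod_eq_one (ι := Fin M₁) D.sum_p
  have hq1 := sum_pi_prod_eq_one (ι := Fin M₂) D.sum_q
  split_ifs with h1 h2
  -- First message correct: `collision₂` holds for arbitrary first letters, so their coincidence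
  -- does not matter and only the second codebook is averaged.
  · have h2 : m'.2 ≠ m.2 := fun h2 => hm (Prod.ext h1 h2)
    simp only [← Finset.mul_sum]
    refine sum_weights_mul_le hp0 hp1 fun c₁ => ?_
    rw [sum_pi_prod_mul_two D.sum_q h2.symm fun y y' =>
      reTrace (D.S (c₁ m'.1) y') (D.σ (c₁ m.1) y)]
    simp only [← Finset.mul_sum]
    exact sum_weights_mul_le D.q_nonneg D.sum_q fun y => collision₂ h _ _ y
  -- Second message correct: the first codebook is averaged with the second held fixed.
  · rw [Finset.sum_comm]
    have e : ∀ c₂ : Fin M₂ → Y, ∑ c₁ : Fin M₁ → X, (∏ k, D.p (c₁ k)) * ((∏ k, D.q (c₂ k)) *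
        reTrace (D.S (c₁ m'.1) (c₂ m'.2)) (D.σ (c₁ m.1) (c₂ m.2))) =
        (∏ k, D.q (c₂ k)) * ∑ c₁ : Fin M₁ → X, (∏ k, D.p (c₁ k)) *
          reTrace (D.S (c₁ m'.1) (c₂ m'.2)) (D.σ (c₁ m.1) (c₂ m.2)) := fun c₂ => by
      rw [Finset.mul_sum]
      exact Finset.sum_congr rfl fun c₁ _ => mul_left_comm _ _ _
    simp only [e]
    refine sum_weights_mul_le hq0 hq1 fun c₂ => ?_
    rw [sum_pi_prod_mul_two D.sum_p h1 fun x' x =>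
      reTrace (D.S x' (c₂ m'.2)) (D.σ x (c₂ m.2))]
    simp only [← Finset.mul_sum]
    exact sum_weights_mul_le D.p_nonneg D.sum_p fun x' => collision₁ h x' _ _
  · have e : ∀ c₁ : Fin M₁ → X, ∑ c₂ : Fin M₂ → Y, (∏ k, D.p (c₁ k)) * ((∏ k, D.q (c₂ k)) *
        reTrace (D.S (c₁ m'.1) (c₂ m'.2)) (D.σ (c₁ m.1) (c₂ m.2))) =
        (∏ k, D.p (c₁ k)) * ∑ y', ∑ y, D.q y' * (D.q y *
          reTrace (D.S (c₁ m'.1) y') (D.σ (c₁ m.1) y)) := fun c₁ => by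
      rw [← Finset.mul_sum, sum_pi_prod_mul_two D.sum_q h2 fun y' y =>
        reTrace (D.S (c₁ m'.1) y') (D.σ (c₁ m.1) y)]
    simp only [e]
    rw [sum_pi_prod_mul_two D.sum_p h1 fun x' x => ∑ y', ∑ y, D.q y' * (D.q y *
          reTrace (D.S x' y') (D.σ x y))]
    simp only [← Finset.mul_sum]
    refine sum_weights_mul_le D.p_nonneg D.sum_p fun x' => ?_
    -- All four letters are independent; the true pair is averaged innermost, for a fixed wrong
    -- pair, as `collision₁₂` requires.
    have e' : ∑ x, D.p x * ∑ y', D.q y' * ∑ y, D.q y * reTrace (D.S x' y') (D.σ x y) =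
        ∑ y', D.q y' * ∑ y, D.q y * ∑ x, D.p x * reTrace (D.S x' y') (D.σ x y) := by
      simp only [Finset.mul_sum]
      rw [Finset.sum_comm]
      refine Finset.sum_congr rfl fun y' _ => ?_
      rw [Finset.sum_comm]
      exact Finset.sum_congr rfl fun y _ => Finset.sum_congr rfl fun x _ => by ring
    rw [e']
    exact sum_weights_mul_le D.q_nonneg D.sum_q fun y' => collision₁₂ h x' y'

/-- The number of wrong message pairs of each kind, with their weights. -/
lemma sum_collision_bound (m : Fin M₁ × Fin M₂) (u₀ u₁ u₂ : ℝ) :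
    ∑ m' ∈ Finset.univ.erase m,
        (if m'.1 = m.1 then u₁ else if m'.2 = m.2 then u₂ else u₀) =
      (M₂ - 1) * u₁ + (M₁ - 1) * u₂ + (M₁ - 1) * (M₂ - 1) * u₀ := by
  have h1 := Finset.add_sum_erase Finset.univ (fun m' : Fin M₁ × Fin M₂ =>
    if m'.1 = m.1 then u₁ else if m'.2 = m.2 then u₂ else u₀) (Finset.mem_univ m)
  rw [if_pos rfl, Fintype.sum_prod_type] at h1
  have h2 : ∀ {M : ℕ} (k : Fin M) (s t : ℝ), ∑ j : Fin M, (if j = k then s else t) =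
      s + (M - 1) * t := by
    intro M k s t
    have : ∀ j : Fin M, (if j = k then s else t) = (if j = k then s - t else 0) + t := fun j => by
      split_ifs <;> ring
    simp only [this, Finset.sum_add_distrib, Finset.sum_ite_eq', Finset.mem_univ, if_true,
      Finset.sum_const, Finset.card_univ, Fintype.card_fin, nsmul_eq_mul]
    ring
  have h3 : ∀ j : Fin M₁, ∑ k : Fin M₂, (if j = m.1 then u₁ else if k = m.2 then u₂ else u₀) =
      if j = m.1 then M₂ * u₁ else u₂ + (M₂ - 1) * u₀ := by
    intro j
    split_ifs with hj
    · simp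
    · exact h2 _ _ _
  simp only [h3, h2] at h1
  linarith

/-- The one-shot bound on the expected average error of the square-root measurement. -/
theorem expected_error_le (h : D.IsBounded a b₀ b₁ b₂) {ε : ℝ} (hε : D.IsTypical ε)
    (hM₁ : 1 ≤ M₁) (hM₂ : 1 ≤ M₂) :
    ∑ c₁ : Fin M₁ → X, ∑ c₂ : Fin M₂ → Y, (∏ k, D.p (c₁ k)) * (∏ k, D.q (c₂ k)) *
        (1 / ((M₁ : ℝ) * (M₂ : ℝ)) * ∑ m : Fin M₁ × Fin M₂,
          reTrace (1 - squareRootMeasurement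
            (fun m' : Fin M₁ × Fin M₂ => D.S (c₁ m'.1) (c₂ m'.2)) m)
            (D.ρ (c₁ m.1) (c₂ m.2))) ≤
      242 * ε + 8 * ((M₂ - 1) * (a * b₁) + (M₁ - 1) * (a * b₂) +
        (M₁ - 1) * (M₂ - 1) * (a * b₀)) := by
  have hM₁' : (0 : ℝ) < M₁ := by exact_mod_cast hM₁
  have hM₂' : (0 : ℝ) < M₂ := by exact_mod_cast hM₂
  set B := (M₂ - 1) * (a * b₁) + (M₁ - 1) * (a * b₂) + (M₁ - 1) * (M₂ - 1) * (a * b₀)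
  set e : (Fin M₁ → X) → (Fin M₂ → Y) → Fin M₁ × Fin M₂ → ℝ := fun c₁ c₂ m =>
    reTrace (1 - squareRootMeasurement
      (fun m' : Fin M₁ × Fin M₂ => D.S (c₁ m'.1) (c₂ m'.2)) m) (D.ρ (c₁ m.1) (c₂ m.2)) with he
  have key : ∀ m : Fin M₁ × Fin M₂,
      ∑ c₁ : Fin M₁ → X, ∑ c₂ : Fin M₂ → Y,
        (∏ k, D.p (c₁ k)) * ((∏ k, D.q (c₂ k)) * e c₁ c₂ m) ≤ 242 * ε + 8 * B := by
    intro m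
    calc ∑ c₁ : Fin M₁ → X, ∑ c₂ : Fin M₂ → Y,
        (∏ k, D.p (c₁ k)) * ((∏ k, D.q (c₂ k)) * e c₁ c₂ m)
        ≤ ∑ c₁ : Fin M₁ → X, ∑ c₂ : Fin M₂ → Y, (∏ k, D.p (c₁ k)) * ((∏ k, D.q (c₂ k)) *
          (D.loss (c₁ m.1) (c₂ m.2) + 8 * ∑ m' ∈ Finset.univ.erase m,
            reTrace (D.S (c₁ m'.1) (c₂ m'.2)) (D.σ (c₁ m.1) (c₂ m.2)))) := by
          refine Finset.sum_le_sum fun c₁ _ => Finset.sum_le_sum fun c₂ _ => ?_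
          refine mul_le_mul_of_nonneg_left (mul_le_mul_of_nonneg_left (error_le c₁ c₂ m) ?_) ?_
          · exact Finset.prod_nonneg fun k _ => D.q_nonneg _
          · exact Finset.prod_nonneg fun k _ => D.p_nonneg _
      _ = (∑ c₁ : Fin M₁ → X, (∏ k, D.p (c₁ k)) * ∑ c₂ : Fin M₂ → Y, (∏ k, D.q (c₂ k)) *
            D.loss (c₁ m.1) (c₂ m.2)) +
          8 * ∑ m' ∈ Finset.univ.erase m, ∑ c₁ : Fin M₁ → X, ∑ c₂ : Fin M₂ → Y,
            (∏ k, D.p (c₁ k)) * ((∏ k, D.q (c₂ k)) *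
            reTrace (D.S (c₁ m'.1) (c₂ m'.2)) (D.σ (c₁ m.1) (c₂ m.2))) := by
          rw [sum_weighted_sum, Finset.mul_sum, ← Finset.sum_add_distrib]
          refine Finset.sum_congr rfl fun c₁ _ => ?_
          rw [Finset.mul_sum, Finset.mul_sum, ← Finset.sum_add_distrib]
          exact Finset.sum_congr rfl fun c₂ _ => by ring
      _ ≤ 242 * ε + 8 * B := by
          gcongr
          · refine le_of_eq_of_le ?_ (expected_loss_le hε)
            have e1 : ∀ c₁ : Fin M₁ → X, ∑ c₂ : Fin M₂ → Y, (∏ k, D.q (c₂ k)) *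
                D.loss (c₁ m.1) (c₂ m.2) = ∑ y, D.q y * D.loss (c₁ m.1) y := fun c₁ =>
              sum_pi_prod_mul_one D.sum_q m.2 (D.loss (c₁ m.1))
            simp only [e1]
            rw [sum_pi_prod_mul_one D.sum_p m.1 fun x => ∑ y, D.q y * D.loss x y]
            simp only [Finset.mul_sum]
          · refine (Finset.sum_le_sum fun m' hm' =>
              expected_collision_le h (Finset.ne_of_mem_erase hm')).trans_eq ?_
            exact sum_collision_bound m _ _ _
  calc _ = 1 / ((M₁ : ℝ) * (M₂ : ℝ)) * ∑ m : Fin M₁ × Fin M₂,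
        ∑ c₁ : Fin M₁ → X, ∑ c₂ : Fin M₂ → Y,
          (∏ k, D.p (c₁ k)) * ((∏ k, D.q (c₂ k)) * e c₁ c₂ m) := by
        rw [sum_weighted_sum, Finset.mul_sum]
        refine Finset.sum_congr rfl fun c₁ _ => ?_
        rw [Finset.mul_sum]
        exact Finset.sum_congr rfl fun c₂ _ => by ring
    _ ≤ 1 / ((M₁ : ℝ) * (M₂ : ℝ)) * ∑ _m : Fin M₁ × Fin M₂, (242 * ε + 8 * B) := by
        gcongr with m
        exact key m
    _ = 242 * ε + 8 * B := by
        rw [Finset.sum_const, Finset.card_univ, Fintype.card_prod, Fintype.card_fin,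
          Fintype.card_fin, nsmul_eq_mul, Nat.cast_mul]
        field_simp

end Packing

end OneShot

/-! ### The packing data of the channel. -/

section Decoder

open scoped MatrixOrder

variable {X₁ X₂ d : Type*} [Fintype X₁] [Fintype X₂] [Fintype d] [DecidableEq d]
  (p₁ : stdSimplex ℝ X₁) (p₂ : stdSimplex ℝ X₂) (W : X₁ → X₂ → DensityMatrix d)

/-- The packing data of `n` uses of the channel. -/
def channelPacking (n : ℕ) (η : ℝ) : Packing (Fin n → X₁) (Fin n → X₂) (Fin n → d) where
  p x := ∏ i, p₁.1 (x i)
  q y := ∏ i, p₂.1 (y i)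
  p_nonneg _ := Finset.prod_nonneg fun _ _ => p₁.2.1 _
  q_nonneg _ := Finset.prod_nonneg fun _ _ => p₂.2.1 _
  sum_p := sum_pi_prod_eq_one p₁.2.2
  sum_q := sum_pi_prod_eq_one p₂.2.2
  ρ x y := tensorState fun i => W (x i) (y i)
  ρ_nonneg _ _ := tensorState_nonneg _
  trace_ρ _ _ := trace_tensorState _
  P := typProj p₁ p₂ W n η
  P₁ x := typProj₁ p₁ p₂ W η x
  P₂ y := entropyProjector (fun i => avgOver₁ p₁ W (y i)) (entBgivenX₂ p₁ p₂ W) η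
  P₁₂ x y := typProj₁₂ p₁ p₂ W η x y
  P_herm := isHermitian_entropyProjector _ _ _
  P₁_herm _ := isHermitian_entropyProjector _ _ _
  P₂_herm _ := isHermitian_entropyProjector _ _ _
  P₁₂_herm _ _ := isHermitian_entropyProjector _ _ _
  P_idem := entropyProjector_mul_self _ _ _
  P₁_idem _ := entropyProjector_mul_self _ _ _
  P₂_idem _ := entropyProjector_mul_self _ _ _
  P₁₂_idem _ _ := entropyProjector_mul_self _ _ _

variable (n : ℕ) (η : ℝ)

lemma channelPacking_ρ₁ (x : Fin n → X₁) :
    (channelPacking p₁ p₂ W n η).ρ₁ x = tensorState fun i => avgOver₂ p₂ W (x i) :=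
  tensorState_average p₂ fun i => W (x i)

lemma channelPacking_ρ₂ (y : Fin n → X₂) :
    (channelPacking p₁ p₂ W n η).ρ₂ y = tensorState fun i => avgOver₁ p₁ W (y i) :=
  tensorState_average p₁ fun i x₁ => W x₁ (y i)

lemma channelPacking_ρ₀ :
    (channelPacking p₁ p₂ W n η).ρ₀ = tensorState fun _ => avgState p₁ p₂ W := by
  rw [Packing.ρ₀]
  simp only [channelPacking_ρ₁]
  exact tensorState_average p₁ fun _ => avgOver₂ p₂ W

/-- Each bound comes from the definition of its typical window alone, hence for every input string,
typical or not. -/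
lemma channelPacking_isBounded (hn : 0 < n) :
    (channelPacking p₁ p₂ W n η).IsBounded
      ((2 : ℝ) ^ ((n : ℝ) * (entBgivenX₁X₂ p₁ p₂ W + η)))
      ((2 : ℝ) ^ (-((n : ℝ) * (entB p₁ p₂ W - η))))
      ((2 : ℝ) ^ (-((n : ℝ) * (entBgivenX₁ p₁ p₂ W - η))))
      ((2 : ℝ) ^ (-((n : ℝ) * (entBgivenX₂ p₁ p₂ W - η)))) where
  a_nonneg := by positivity
  b₀_nonneg := by positivity
  b₁_nonneg := by positivity
  b₂_nonneg := by positivity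
  P_conj_le := by
    rw [channelPacking_ρ₀]
    exact entropyProjector_conj_le _ hn _ _
  P₁_conj_le x := by
    rw [channelPacking_ρ₁]
    exact entropyProjector_conj_le _ hn _ _
  P₂_conj_le y := by
    rw [channelPacking_ρ₂]
    exact entropyProjector_conj_le _ hn _ _
  P₂_conj_le_self y := by
    rw [channelPacking_ρ₂]
    exact entropyProjector_conj_le_self _ _ _
  P₁₂_le x y := entropyProjector_le _ hn _ _
  trace_P₁₂_le x y := trace_entropyProjector_le _ hn _ _

lemma exists_channelPacking_isTypical {η : ℝ} (hη : 0 < η) :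
    ∃ V : ℝ, ∀ n : ℕ, 0 < n → (channelPacking p₁ p₂ W n η).IsTypical (V / n) := by
  -- The unconditional projector is the case of a constant family; its letter is a dummy that sums
  -- out.
  obtain ⟨V₀, h₀⟩ := expected_atypical_le p₁.1 p₁.2.1 p₁.2.2 (fun _ => avgState p₁ p₂ W) hη
  obtain ⟨V₁, h₁⟩ := expected_atypical_le p₁.1 p₁.2.1 p₁.2.2 (avgOver₂ p₂ W) hη
  obtain ⟨V₂, h₂⟩ := expected_atypical_le p₂.1 p₂.2.1 p₂.2.2 (avgOver₁ p₁ W) hη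
  obtain ⟨V₁₂, h₁₂⟩ := expected_atypical_le (fun x : X₁ × X₂ => p₁.1 x.1 * p₂.1 x.2)
    (fun x => mul_nonneg (p₁.2.1 _) (p₂.2.1 _))
    (by rw [Fintype.sum_prod_type]
        simp only [← Finset.mul_sum, p₁.2.2, p₂.2.2, mul_one]) (fun x => W x.1 x.2) hη
  refine ⟨max (max V₀ V₁) (max V₂ V₁₂), fun n hn => ?_⟩
  have hn' : (0 : ℝ) < n := by exact_mod_cast hn
  constructor
  · refine le_trans (le_of_eq ?_) ((h₀ n hn).trans (div_le_div_of_nonneg_right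
      ((le_max_left _ _).trans (le_max_left _ _)) hn'.le))
    rw [← Finset.sum_mul, ← Finset.sum_mul, sum_pi_prod_eq_one p₁.2.2, p₁.2.2, one_mul, one_mul,
      channelPacking_ρ₀]
    rfl
  · refine le_trans (le_of_eq ?_) ((h₁ n hn).trans (div_le_div_of_nonneg_right
      ((le_max_right _ _).trans (le_max_left _ _)) hn'.le))
    simp only [channelPacking_ρ₁]
    rfl
  · refine le_trans (le_of_eq ?_) ((h₂ n hn).trans (div_le_div_of_nonneg_right
      ((le_max_left _ _).trans (le_max_right _ _)) hn'.le))
    simp only [channelPacking_ρ₂]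
    rfl
  · refine le_trans (le_of_eq ?_) ((h₁₂ n hn).trans (div_le_div_of_nonneg_right
      ((le_max_right _ _).trans (le_max_right _ _)) hn'.le))
    rw [← (Equiv.arrowProdEquivProdArrow (Fin n) (fun _ => X₁) fun _ => X₂).symm.sum_comp,
      Fintype.sum_prod_type, Fintype.sum_prod_type]
    refine Finset.sum_congr rfl fun x _ => Finset.sum_congr rfl fun y _ => ?_
    rw [← mul_assoc, Finset.prod_mul_distrib]
    rfl

/-! ### Rates and the error at block length `n`. -/

variable {p₁ p₂ W n η} {M₁ M₂ : ℕ}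

/-- The count of wrong messages is `M - 1`, and this absorbs the rounding up exactly. It also covers
`t ≤ 1`, where a single message remains and there is nothing to confuse. -/
lemma natCast_sub_one_le_of_le_ceil {M : ℕ} {t : ℝ} (ht : 0 ≤ t) (h : M ≤ ⌈t⌉₊) :
    (M : ℝ) - 1 ≤ t := by
  have h1 := Nat.ceil_lt_add_one ht
  have h2 : (M : ℝ) ≤ ⌈t⌉₊ := by exact_mod_cast h
  linarith

/-- The expected average error of the simultaneous decoder at block length `n`. -/
lemma expectedAverageError_simultaneousDecoder_le {R₁ R₂ δ ε : ℝ}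
    (hR₁ : R₁ ≤ infoX₁ p₁ p₂ W) (hR₂ : R₂ ≤ infoX₂ p₁ p₂ W)
    (hR₁₂ : R₁ + R₂ ≤ infoX₁X₂ p₁ p₂ W) (hδ : 0 ≤ δ) (hn : 0 < n)
    (hε : (channelPacking p₁ p₂ W n η).IsTypical ε)
    (hM₁ : 1 ≤ M₁) (hM₁' : M₁ ≤ ⌈(2 : ℝ) ^ ((n : ℝ) * (R₁ - δ))⌉₊)
    (hM₂ : 1 ≤ M₂) (hM₂' : M₂ ≤ ⌈(2 : ℝ) ^ ((n : ℝ) * (R₂ - δ))⌉₊) :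
    expectedAverageError (M₁ := M₁) (M₂ := M₂) (n := n) p₁ p₂ W
      (simultaneousDecoder p₁ p₂ W η) ≤
      242 * ε + 24 * (2 : ℝ) ^ (-((δ - 2 * η) * n)) := by
  have h := Packing.expected_error_le (channelPacking_isBounded p₁ p₂ W n η hn) hε hM₁ hM₂
  -- The channel's expected error is the one-shot expression by definitional unfolding.
  refine le_trans (le_of_eq rfl) (h.trans ?_)
  have hn' : (0 : ℝ) ≤ n := n.cast_nonneg
  have h1 := natCast_sub_one_le_of_le_ceil (by positivity) hM₁'
  have h2 := natCast_sub_one_le_of_le_ceil (by positivity) hM₂'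
  have h1' : (0 : ℝ) ≤ M₁ - 1 := by
    rw [sub_nonneg]
    exact_mod_cast hM₁
  have h2' : (0 : ℝ) ≤ M₂ - 1 := by
    rw [sub_nonneg]
    exact_mod_cast hM₂
  rw [infoX₁] at hR₁
  rw [infoX₂] at hR₂
  rw [infoX₁X₂] at hR₁₂
  -- Number of wrong pairs `2^{ns}`, projector size `2^{nt}`, eigenvalue bound `2^{-nu}`. The three
  -- kinds share the final bound, whence 24 = 8 · 3.
  have key : ∀ {A s t u : ℝ}, 0 ≤ A → A ≤ (2 : ℝ) ^ ((n : ℝ) * s) →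
      s + t - u ≤ -(δ - 2 * η) →
      A * ((2 : ℝ) ^ ((n : ℝ) * t) * (2 : ℝ) ^ (-((n : ℝ) * u))) ≤
        (2 : ℝ) ^ (-((δ - 2 * η) * n)) := by
    intro A s t u _ hA hs
    calc A * ((2 : ℝ) ^ ((n : ℝ) * t) * (2 : ℝ) ^ (-((n : ℝ) * u)))
        ≤ (2 : ℝ) ^ ((n : ℝ) * s) * ((2 : ℝ) ^ ((n : ℝ) * t) * (2 : ℝ) ^ (-((n : ℝ) * u))) := by
          gcongr
      _ = (2 : ℝ) ^ ((n : ℝ) * (s + t - u)) := by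
          rw [← Real.rpow_add two_pos, ← Real.rpow_add two_pos]
          congr 1
          ring
      _ ≤ (2 : ℝ) ^ (-((δ - 2 * η) * n)) := by
          refine Real.rpow_le_rpow_of_exponent_le one_le_two ?_
          nlinarith
  have k1 := key (t := entBgivenX₁X₂ p₁ p₂ W + η) (u := entBgivenX₁ p₁ p₂ W - η) h2' h2
    (by linarith)
  have k2 := key (t := entBgivenX₁X₂ p₁ p₂ W + η) (u := entBgivenX₂ p₁ p₂ W - η) h1' h1
    (by linarith)
  -- With both messages wrong the exponent gains `2 δ - 2 η`, which is at least `δ - 2 η` since `0 ≤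
  -- δ`.
  have k0 := key (s := R₁ - δ + (R₂ - δ)) (t := entBgivenX₁X₂ p₁ p₂ W + η)
    (u := entB p₁ p₂ W - η) (mul_nonneg h1' h2')
    ((mul_le_mul h1 h2 h2' (by positivity)).trans_eq (by
      rw [← Real.rpow_add two_pos, mul_add])) (by linarith)
  linarith

/-! ### Completion to a POVM on the message pairs. -/

variable (p₁ p₂ W η)

lemma sandwich_nonneg (c₁ : Codebook X₁ M₁ n) (c₂ : Codebook X₂ M₂ n) (m : Fin M₁ × Fin M₂) :
    0 ≤ sandwich p₁ p₂ W η c₁ c₂ m :=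
  (channelPacking p₁ p₂ W n η).S_nonneg (c₁ m.1) (c₂ m.2)

/-- The simultaneous decoder, with the failure outcome assigned to the message pair `m₀`. -/
def completedDecoder (m₀ : Fin M₁ × Fin M₂) (c₁ : Codebook X₁ M₁ n) (c₂ : Codebook X₂ M₂ n)
    (m : Fin M₁ × Fin M₂) : Matrix (Fin n → d) (Fin n → d) ℂ :=
  simultaneousDecoder p₁ p₂ W η c₁ c₂ m +
    if m = m₀ then 1 - ∑ m', simultaneousDecoder p₁ p₂ W η c₁ c₂ m' else 0

lemma simultaneousDecoder_le_completedDecoder (m₀ : Fin M₁ × Fin M₂) (c₁ : Codebook X₁ M₁ n)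
    (c₂ : Codebook X₂ M₂ n) (m : Fin M₁ × Fin M₂) :
    simultaneousDecoder p₁ p₂ W η c₁ c₂ m ≤ completedDecoder p₁ p₂ W η m₀ c₁ c₂ m := by
  refine le_add_of_nonneg_right ?_
  split_ifs
  · exact sub_nonneg.2 (sum_squareRootMeasurement_le_one (sandwich_nonneg p₁ p₂ W η c₁ c₂))
  · exact le_rfl

lemma isPOVM_completedDecoder (m₀ : Fin M₁ × Fin M₂) (c₁ : Codebook X₁ M₁ n)
    (c₂ : Codebook X₂ M₂ n) : IsPOVM (completedDecoder p₁ p₂ W η m₀ c₁ c₂) := by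
  refine ⟨fun m => ?_, ?_⟩
  · rw [← Matrix.nonneg_iff_posSemidef]
    exact (squareRootMeasurement_nonneg (sandwich_nonneg p₁ p₂ W η c₁ c₂) m).trans
      (simultaneousDecoder_le_completedDecoder p₁ p₂ W η m₀ c₁ c₂ m)
  · simp [completedDecoder, Finset.sum_add_distrib]

/-- Enlarging the operators shrinks `1 - Λ`, so the completed decoder inherits the error bound
whichever pair receives the failure outcome. -/
lemma expectedAverageError_mono {Λ Λ' : Codebook X₁ M₁ n → Codebook X₂ M₂ n →
      Fin M₁ × Fin M₂ → Matrix (Fin n → d) (Fin n → d) ℂ}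
    (h : ∀ c₁ c₂ m, Λ c₁ c₂ m ≤ Λ' c₁ c₂ m) :
    expectedAverageError p₁ p₂ W Λ' ≤ expectedAverageError p₁ p₂ W Λ := by
  refine Finset.sum_le_sum fun c₁ _ => Finset.sum_le_sum fun c₂ _ => ?_
  have h1 : 0 ≤ codebookProb p₁ c₁ :=
    Finset.prod_nonneg fun _ _ => Finset.prod_nonneg fun _ _ => p₁.2.1 _
  have h2 : 0 ≤ codebookProb p₂ c₂ :=
    Finset.prod_nonneg fun _ _ => Finset.prod_nonneg fun _ _ => p₂.2.1 _
  refine mul_le_mul_of_nonneg_left ?_ (mul_nonneg h1 h2)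
  refine mul_le_mul_of_nonneg_left (Finset.sum_le_sum fun m _ => ?_) (by positivity)
  exact reTrace_mono_left (sub_le_sub_left (h c₁ c₂ m) 1) (tensorState_nonneg _)

end Decoder

end QuantumMAC

end

/-! ### The asymptotic theorem. -/

theorem mainTheorem1
    {X₁ X₂ d : Type*} [Fintype X₁] [Fintype X₂] [Fintype d] [DecidableEq d]
    (W : X₁ → X₂ → QuantumMAC.DensityMatrix d)
    (p₁ : stdSimplex ℝ X₁) (p₂ : stdSimplex ℝ X₂) (R₁ R₂ : ℝ)
    (hR₁ : R₁ ≤ QuantumMAC.infoX₁ p₁ p₂ W)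
    (hR₂ : R₂ ≤ QuantumMAC.infoX₂ p₁ p₂ W)
    (hR₁₂ : R₁ + R₂ ≤ QuantumMAC.infoX₁X₂ p₁ p₂ W)
    (ε δ η : ℝ) (hε : 0 < ε) (hδ : 0 < δ) (hη : 0 < η) (hηδ : η < δ / 2) :
    ∃ N : ℕ, ∀ n : ℕ, N ≤ n → ∀ M₁ M₂ : ℕ,
      1 ≤ M₁ → M₁ ≤ ⌈(2 : ℝ) ^ ((n : ℝ) * (R₁ - δ))⌉₊ →
      1 ≤ M₂ → M₂ ≤ ⌈(2 : ℝ) ^ ((n : ℝ) * (R₂ - δ))⌉₊ →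
      -- the square-root measurement, completed by a failure outcome, is a POVM
      (∀ (c₁ : QuantumMAC.Codebook X₁ M₁ n) (c₂ : QuantumMAC.Codebook X₂ M₂ n),
        QuantumMAC.IsPOVM
          (QuantumMAC.withFailure (QuantumMAC.simultaneousDecoder p₁ p₂ W η c₁ c₂))) ∧
      -- its expected average error probability is at most `ε`
      QuantumMAC.expectedAverageError (M₁ := M₁) (M₂ := M₂) (n := n) p₁ p₂ W
        (QuantumMAC.simultaneousDecoder p₁ p₂ W η) ≤ ε ∧
      -- it extends to a POVM indexed by the message pairs alone, with the same error bound
      ∃ Λ : QuantumMAC.Codebook X₁ M₁ n → QuantumMAC.Codebook X₂ M₂ n →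
          Fin M₁ × Fin M₂ → Matrix (Fin n → d) (Fin n → d) ℂ,
        (∀ c₁ c₂, QuantumMAC.IsPOVM (Λ c₁ c₂)) ∧
        (∀ c₁ c₂ m,
          (Λ c₁ c₂ m - QuantumMAC.simultaneousDecoder p₁ p₂ W η c₁ c₂ m).PosSemidef) ∧
        QuantumMAC.expectedAverageError p₁ p₂ W Λ ≤ ε := by
  obtain ⟨V, hV⟩ := QuantumMAC.exists_channelPacking_isTypical p₁ p₂ W hη
  have hlim : Filter.Tendsto
      (fun n : ℕ => 242 * (V / n) + 24 * (2 : ℝ) ^ (-((δ - 2 * η) * n)))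
      Filter.atTop (nhds 0) := by
    have h1 : Filter.Tendsto (fun n : ℕ => V / (n : ℝ)) Filter.atTop (nhds 0) :=
      tendsto_const_div_atTop_nhds_zero_nat V
    have h2 : Filter.Tendsto (fun n : ℕ => (2 : ℝ) ^ (-((δ - 2 * η) * n)))
        Filter.atTop (nhds 0) :=
      (tendsto_rpow_atBot_of_base_gt_one 2 one_lt_two).comp
        (Filter.tendsto_neg_atTop_atBot.comp
          (tendsto_natCast_atTop_atTop.const_mul_atTop (by linarith)))
    simpa using (h1.const_mul 242).add (h2.const_mul 24)
  obtain ⟨N, hN⟩ := Filter.eventually_atTop.1 (hlim.eventually_le_const hε)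
  refine ⟨max N 1, fun n hn M₁ M₂ hM₁ hM₁' hM₂ hM₂' => ?_⟩
  have hn0 : 0 < n := lt_of_lt_of_le one_pos ((le_max_right N 1).trans hn)
  have hbound := (QuantumMAC.expectedAverageError_simultaneousDecoder_le hR₁ hR₂ hR₁₂ hδ.le hn0
    (hV n hn0) hM₁ hM₁' hM₂ hM₂').trans (hN n ((le_max_left N 1).trans hn))
  refine ⟨fun c₁ c₂ => QuantumMAC.isPOVM_withFailure_squareRootMeasurement
    (QuantumMAC.sandwich_nonneg p₁ p₂ W η c₁ c₂), hbound, ?_⟩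
  -- Nonempty message sets supply the pair `(0, 0)`, which receives the failure outcome for all
  -- codebooks.
  exact ⟨QuantumMAC.completedDecoder p₁ p₂ W η (⟨0, hM₁⟩, ⟨0, hM₂⟩),
    QuantumMAC.isPOVM_completedDecoder p₁ p₂ W η _,
    QuantumMAC.simultaneousDecoder_le_completedDecoder p₁ p₂ W η _,
    (QuantumMAC.expectedAverageError_mono p₁ p₂ W
      (QuantumMAC.simultaneousDecoder_le_completedDecoder p₁ p₂ W η _)).trans hbound⟩
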